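/- Let $X$ be an $n$-dimensional normal complex algebraic variety (an integral separated scheme of finite type over $\mathbb{C}$ whose local rings are integrally closed) and let $B$ be a Weil divisor on $X$ such that $(X,B)$ is a cluster type pair. This means that there are a closed subset $Z\subset \mathbb{G}_m^n=\operatorname{Spec}\mathbb{C}[x_1^{\pm 1},\dots,x_n^{\pm 1}]$ of codimension at least two (possibly empty) and an open embedding $j\colon \mathbb{G}_m^n\setminus Z\hookrightarrow X$ over $\mathbb{C}$ such that the volume form $$\Omega_n=\frac{dx_1\wedge\dots\wedge dx_n}{x_1\cdots x_n},$$ regarded via $j$ as a rational $n$-form on $X$, has no zeros along any prime divisor of $X$, and $B$ is the divisor of poles of this form. Let $X^{\rm sm}$ be the smooth locus of $X$, and equip the set of complex points of $X^{\rm sm}\setminus B$ (the complement in $X^{\rm sm}$ of the support of $B$) with the Euclidean topology. Then $X^{\rm sm}\setminus B$ is path-connected, and for every base point its fundamental group $\pi_1(X^{\rm sm}\setminus B)$ is abelian of rank at most $n=\dim X$, that is, it can be generated by at most $n$ elements; in other words, there is a surjective homomorphism $\mathbb{Z}^n\to \pi_1(X^{\rm sm}\setminus B)$. -/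

import Mathlib

open AlgebraicGeometry CategoryTheory

noncomputable section

namespace ClusterType

/-- The base scheme `Spec ℂ`. -/
abbrev SpecC : Scheme.{0} := Spec (.of ℂ)

/-! ### Complex points with the Euclidean topology -/

/-- The set `X(ℂ)` of complex points of a scheme over `ℂ`. -/
def ComplexPoints (X : Scheme.{0}) [X.Over SpecC] : Type :=
  {p : SpecC ⟶ X // p ≫ (X ↘ SpecC) = 𝟙 SpecC}

namespace ComplexPoints

variable {X : Scheme.{0}} [X.Over SpecC]

/-- The underlying (closed) point of `X`. -/
def pt (p : ComplexPoints X) : X := p.1 (IsLocalRing.closedPoint ℂ)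

/-- The value at `p` of a regular function defined on an open `U` through which `p` factors. -/
def eval (p : ComplexPoints X) (U : X.Opens) (h : ⊤ ≤ p.1 ⁻¹ᵁ U) (f : Γ(X, U)) : ℂ :=
  (Scheme.ΓSpecIso (.of ℂ)).hom (p.1.appLE U ⊤ h f)

/-- The Euclidean (analytic) topology on `X(ℂ)`: the coarsest one in which `U(ℂ)` is open
for every Zariski open `U` and every regular function `U(ℂ) → ℂ` is continuous. -/
instance : TopologicalSpace (ComplexPoints X) :=
  TopologicalSpace.generateFrom
    {S | ∃ (U : X.Opens) (f : Γ(X, U)) (W : Set ℂ), IsOpen W ∧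
      S = {p | ∃ h : ⊤ ≤ p.1 ⁻¹ᵁ U, p.eval U h f ∈ W}}

end ComplexPoints

/-! ### The algebraic torus -/

/-- The algebraic torus `𝔾ₘⁿ = Spec ℂ[x₁^±, …, xₙ^±]`. -/
def torus (n : ℕ) : Scheme.{0} := Spec (.of (AddMonoidAlgebra ℂ (Fin n → ℤ)))

instance (n : ℕ) : (torus n).Over SpecC :=
  ⟨Spec.map (CommRingCat.ofHom (algebraMap ℂ (AddMonoidAlgebra ℂ (Fin n → ℤ))))⟩

/-- The coordinate function `xᵢ` on the torus. -/
def torusCoord (n : ℕ) (i : Fin n) : Γ(torus n, ⊤) :=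
  (Scheme.ΓSpecIso (.of (AddMonoidAlgebra ℂ (Fin n → ℤ)))).inv
    (AddMonoidAlgebra.single (Pi.single i 1) 1)

instance (n : ℕ) : IsIntegral (torus n) := by
  unfold torus
  infer_instance

/-- An embedding in codimension one `𝔾ₘⁿ ⇢ X`: an open embedding over `ℂ` of `𝔾ₘⁿ ∖ Z`,
where `Z` is a closed subset all of whose points have codimension at least two. -/
structure CodimOneEmbedding (n : ℕ) (X : Scheme.{0}) [X.Over SpecC] where
  /-- The open subset `𝔾ₘⁿ ∖ Z`. -/
  dom : (torus n).Opens
  two_le_codim : ∀ z : torus n, z ∉ dom → 2 ≤ Order.coheight z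
  /-- The embedding of `𝔾ₘⁿ ∖ Z`. -/
  hom : dom.toScheme ⟶ X
  isOver : hom.IsOver SpecC
  isOpenImmersion : IsOpenImmersion hom

attribute [instance] CodimOneEmbedding.isOver CodimOneEmbedding.isOpenImmersion

/-! ### Rational differential forms -/

section Forms

variable (X : Scheme.{0}) [X.Over SpecC] [IsIntegral X]

/-- The function field of an integral scheme over `ℂ` as a `ℂ`-algebra. -/
instance functionFieldAlgebra : Algebra ℂ X.functionField :=
  ((Scheme.ΓSpecIso (.of ℂ)).inv ≫ (X ↘ SpecC).appTop ≫
    X.presheaf.germ ⊤ (genericPoint X) trivial).hom.toAlgebra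

/-- Rational differential `n`-forms on `X`. -/
abbrev RationalForm (n : ℕ) : Type :=
  ⋀[X.functionField]^n (KaehlerDifferential ℂ X.functionField)

variable {X}

/-- The rational `n`-forms that are regular at `z`: the `𝒪_{X,z}`-span of the forms
`da₁ ∧ … ∧ daₙ` with `aᵢ ∈ 𝒪_{X,z}`, i.e. the image of `⋀ⁿ Ω_{𝒪_{X,z}/ℂ}`. -/
def regularFormsAt (n : ℕ) (z : X) :
    Submodule (algebraMap (X.presheaf.stalk z) X.functionField).range (RationalForm X n) :=
  Submodule.span _ (Set.range fun a : Fin n → X.presheaf.stalk z =>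
    exteriorPower.ιMulti X.functionField n
      fun i => KaehlerDifferential.D ℂ X.functionField (algebraMap _ X.functionField (a i)))

/-- The form `ω` vanishes at the point `z` (used at points of codimension one):
it is a multiple of a regular form by an element of the maximal ideal. -/
def HasZeroAt {n : ℕ} (ω : RationalForm X n) (z : X) : Prop :=
  ∃ a ∈ IsLocalRing.maximalIdeal (X.presheaf.stalk z), ∃ η ∈ regularFormsAt n z,
    ω = algebraMap (X.presheaf.stalk z) X.functionField a • η

/-- The order of the pole of `ω` at the point `z` (used at points of codimension one):
the least `k ≥ 0` such that `𝔪_z ^ k • ω` consists of regular forms. It is `0` if and only if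
`ω` is regular at `z`. -/
def poleOrder {n : ℕ} (ω : RationalForm X n) (z : X) : ℕ :=
  sInf {k : ℕ | ∀ a ∈ IsLocalRing.maximalIdeal (X.presheaf.stalk z) ^ k,
    algebraMap (X.presheaf.stalk z) X.functionField a • ω ∈ regularFormsAt n z}

end Forms

namespace CodimOneEmbedding

variable {n : ℕ} {X : Scheme.{0}} [X.Over SpecC] (j : CodimOneEmbedding n X)

instance nonempty_dom : Nonempty j.dom := by
  by_contra h
  have hg : genericPoint (torus n) ∉ j.dom := fun hg => h ⟨⟨_, hg⟩⟩
  have h0 : Order.coheight (genericPoint (torus n)) = 0 := by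
    rw [Order.coheight_eq_zero]
    intro y _
    exact (genericPoint_spec (torus n)).specializes trivial
  have := j.two_le_codim _ hg
  rw [h0] at this
  exact absurd this (by decide)

instance nonempty_image : Nonempty (j.hom ''ᵁ (⊤ : j.dom.toScheme.Opens)) :=
  ⟨⟨j.hom j.nonempty_dom.some, ⟨_, trivial, rfl⟩⟩⟩

/-- The coordinate `xᵢ` of the torus, regarded as a rational function on `X` through `j`. -/
def coord [IsIntegral X] (i : Fin n) : X.functionField :=
  X.germToFunctionField (j.hom ''ᵁ ⊤) ((j.hom.appIso ⊤).inv (j.dom.ι.appTop (torusCoord n i)))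

/-- The volume form `Ωₙ = dx₁/x₁ ∧ … ∧ dxₙ/xₙ` of the torus, regarded as a rational form
on `X` through `j`. -/
def volumeForm [IsIntegral X] : RationalForm X n :=
  exteriorPower.ιMulti X.functionField n
    fun i => (j.coord i)⁻¹ • KaehlerDifferential.D ℂ X.functionField (j.coord i)

end CodimOneEmbedding

/-! ### Cluster type pairs -/

open Classical in
/-- For an `n`-dimensional normal complex variety `X` and a Weil divisor `B` on `X`: the pair
`(X, B)` is of cluster type if there is an embedding in codimension one `𝔾ₘⁿ ⇢ X` such that
`Ωₙ` has no zeros (along prime divisors of `X`) and `B` is its divisor of poles.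
Prime divisors are represented by their generic points. -/
def IsClusterTypePair (n : ℕ) (X : Scheme.{0}) [X.Over SpecC] [IsIntegral X]
    (B : AlgebraicCycle X ℤ) : Prop :=
  ∃ j : CodimOneEmbedding n X,
    (∀ z : X, Order.coheight z = 1 → ¬ HasZeroAt j.volumeForm z) ∧
    ∀ z : X, B z = if Order.coheight z = 1 then (poleOrder j.volumeForm z : ℤ) else 0

/-- The support of a divisor: the union of the closures of the points with nonzero coefficient. -/
def divisorSupport {X : Scheme.{0}} (B : AlgebraicCycle X ℤ) : Set X :=
  ⋃ z ∈ {z : X | B z ≠ 0}, closure {z}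

/-- The complex points of `X^sm ∖ B`, with the Euclidean topology. -/
abbrev SmoothComplement (X : Scheme.{0}) [X.Over SpecC] [LocallyOfFiniteType (X ↘ SpecC)]
    (B : AlgebraicCycle X ℤ) : Type :=
  {p : ComplexPoints X // p.pt ∈ (X ↘ SpecC).smoothLocus ∧ p.pt ∉ divisorSupport B}

end ClusterType

end

/-! Each coordinate is a unit on the torus, so the volume form is regular along the image of the
embedding. Hence the image misses `B`, and it lies in the smooth locus because the torus is smooth.
From there the fundamental group is bounded from above by a chain of surjections, all instances of
one principle: in a connected complex manifold, a nonempty Zariski open part carries all loops up to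
homotopy, since its complement has real codimension at least two.

`IsTame` is the local form of this principle: small simply connected neighbourhoods in which the
subset contains an open, dense, path connected core. A path can be pushed piece by piece into a tame
open subset (`IsTame.exists_path_homotopic`), so open embeddings with tame image are surjective on
`π₁` (`map_surjective_of_isTame`). At smooth points tameness is checked in charts, where a proper
Zariski closed subset lies in a hypersurface (`isTame_setOf_pt_mem`).

A closed subset of codimension at least two in the torus lies in the common zeros of two relatively
prime polynomials `f`, `g` (`exists_isRelPrime_of_two_le_codim`). It therefore suffices to show that
`π₁` of `torusCompl f g` is a quotient of `ℤⁿ`, which goes by induction on `n`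
(`isQuotientOfLattice_torusCompl`). Eliminating the first coordinate gives a nonzero `r` in the
ideal of `f` and `g` that involves only the others. The product of `ℂˣ` with `torusCompl r 0` is
then a tame open subset, so all loops come from its two factors. At a general height `t` the slice
extends to `torusCompl r k`, where `k` is a combination of `f` and `g` restricted to that height and
is relatively prime to `r`. Loops of the second factor thus pass through a group covered by the
induction hypothesis, and `ℂˣ` adds one generator that commutes with them. -/

noncomputable section

namespace ClusterType

open Set Topology unitInterval

/-! ### Tame subsets and pushing paths into them. -/

section Topology

variable {Y : Type*} [TopologicalSpace Y]

/-- Two paths with the same endpoints inside a simply connected subset are homotopic. -/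
theorem homotopic_of_forall_mem {D : Set Y} (hD : IsSimplyConnected D) {x y : Y} (p q : Path x y)
    (hp : ∀ t, p t ∈ D) (hq : ∀ t, q t ∈ D) : p.Homotopic q := by
  have := hD.simplyConnectedSpace
  have hx : x ∈ D := by simpa using hp 0
  have hy : y ∈ D := by simpa using hp 1
  let p' : Path (⟨x, hx⟩ : D) ⟨y, hy⟩ :=
    ⟨⟨fun t => ⟨p t, hp t⟩, by fun_prop⟩, by simp, by simp⟩
  let q' : Path (⟨x, hx⟩ : D) ⟨y, hy⟩ :=
    ⟨⟨fun t => ⟨q t, hq t⟩, by fun_prop⟩, by simp, by simp⟩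
  have h := (SimplyConnectedSpace.paths_homotopic p' q').map ⟨Subtype.val, continuous_subtype_val⟩
  exact h

/-- An open set `D` which is simply connected and in which `S` contains an open, dense and
path connected subset. -/
structure IsTameIn (S D : Set Y) : Prop where
  isOpen : IsOpen D
  isSimplyConnected : IsSimplyConnected D
  exists_core : ∃ C, C ⊆ D ∧ C ⊆ S ∧ IsOpen C ∧ D ⊆ closure C ∧ IsPathConnected C

/-- `S` is tame in `Y` if every point of `Y` has arbitrarily small neighbourhoods
in which `S` is tame. -/
def IsTame (S : Set Y) : Prop := ∀ y : Y, ∀ N ∈ 𝓝 y, ∃ D ⊆ N, y ∈ D ∧ IsTameIn S D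

theorem IsTameIn.mono {S S' D : Set Y} (h : IsTameIn S D) (hS : S ⊆ S') : IsTameIn S' D := by
  obtain ⟨C, h1, h2, h3⟩ := h.exists_core
  exact ⟨h.1, h.2, C, h1, h2.trans hS, h3⟩

theorem IsTame.mono {S S' : Set Y} (h : IsTame S) (hS : S ⊆ S') : IsTame S' := by
  intro y N hN
  obtain ⟨D, hD, hy, ht⟩ := h y N hN
  exact ⟨D, hD, hy, ht.mono hS⟩

/-- A path, starting in `S`, of a tame space is homotopic to a path in `S` after a modification
near its end point. -/
theorem IsTame.exists_path_homotopic_subpath {S : Set Y} (hS : IsTame S) (hSo : IsOpen S)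
    {a b : Y} (ha : a ∈ S) (γ : Path a b) (s : I) {D C : Set Y} (hD : IsOpen D)
    (hDs : IsSimplyConnected D) (hCD : C ⊆ D) (hCS : C ⊆ S) (hC : IsOpen C) (hDC : D ⊆ closure C)
    (hCp : IsPathConnected C) {u : Y} (hu : u ∈ C) (δ : Path (γ s) u) (hδ : ∀ t, δ t ∈ D) :
    ∃ p : Path (γ 0) u, (∀ t, p t ∈ S) ∧ p.Homotopic ((γ.subpath 0 s).trans δ) := by
  choose D₀ hD₀ hyD₀ hT using fun t : I => hS (γ t) univ Filter.univ_mem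
  obtain ⟨τ, hτ0, hτm, ⟨m, hm⟩, hτ⟩ := exists_monotone_Icc_subset_open_cover_unitInterval
    (c := fun t : I => γ ⁻¹' (D₀ t) ∩ univ)
    (fun t => ((hT t).isOpen.preimage γ.continuous).inter isOpen_univ)
    (fun t _ => mem_iUnion.2 ⟨t, hyD₀ t, trivial⟩)
  -- the claim for all `s ≤ τ k`
  have key : ∀ k : ℕ, ∀ s : I, s ≤ τ k → ∀ {D C : Set Y} (_ : IsOpen D)
      (_ : IsSimplyConnected D) (_ : C ⊆ D) (_ : C ⊆ S) (_ : IsOpen C) (_ : D ⊆ closure C)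
      (_ : IsPathConnected C) {u : Y} (_ : u ∈ C) (δ : Path (γ s) u) (_ : ∀ t, δ t ∈ D),
      ∃ p : Path (γ 0) u, (∀ t, p t ∈ S) ∧ p.Homotopic ((γ.subpath 0 s).trans δ) := by
    intro k
    induction k with
    | zero =>
      intro s hs D C hD hDs hCD hCS hC hDC hCp u hu δ hδ
      obtain rfl : s = 0 := le_antisymm (hs.trans hτ0.le) s.2.1
      have haD : γ 0 ∈ D := by simpa using hδ 0
      -- Since `N ⊆ D ∩ S`, the way from `γ 0` to the core `C` stays in `S`; the homotopy is free
      -- because everything happens in the simply connected `D`.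
      obtain ⟨N, hN, haN, hNt⟩ := hS (γ 0) (D ∩ S)
        ((hD.inter hSo).mem_nhds ⟨haD, by simpa using ha⟩)
      obtain ⟨v, hvN, hvC⟩ := mem_closure_iff.1 (hDC haD) N hNt.isOpen haN
      obtain ⟨ε, hε⟩ := hNt.isSimplyConnected.isPathConnected.joinedIn _ haN _ hvN
      obtain ⟨ζ, hζ⟩ := hCp.joinedIn _ hvC _ hu
      refine ⟨ε.trans ζ, fun t => ?_, ?_⟩
      · rw [Path.trans_apply]
        split_ifs
        exacts [(hN (hε _)).2, hCS (hζ _)]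
      · refine homotopic_of_forall_mem hDs _ _ (fun t => ?_) (fun t => ?_)
        · rw [Path.trans_apply]
          split_ifs
          exacts [(hN (hε _)).1, hCD (hζ _)]
        · rw [Path.trans_apply]
          split_ifs
          · simpa using haD
          · exact hδ _
    | succ k ih =>
      intro s hs D C hD hDs hCD hCS hC hDC hCp u hu δ hδ
      by_cases hsk : s ≤ τ k
      · exact ih s hsk hD hDs hCD hCS hC hDC hCp hu δ hδ
      obtain ⟨i, hi⟩ := hτ k
      replace hsk := (not_le.1 hsk).le
      have hsD : γ s ∈ D := by simpa using hδ 0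
      have hsD₀ : γ s ∈ D₀ i := (hi ⟨hsk, hs⟩).1
      obtain ⟨C₀, hCD₀, hCS₀, hCo₀, hDC₀, hCp₀⟩ := (hT i).exists_core
      -- Change of neighbourhood at `γ s`: density of `C` and then of `C₀` gives a point `v` of both
      -- cores, joined to `γ s` by a path in `D ∩ D₀ i`. The induction hypothesis, with `D₀ i` and
      -- core `C₀`, leads to `v` inside `S`; from there one continues to `u` in `C`.
      obtain ⟨N, hN, hsN, hNt⟩ := hS (γ s) (D ∩ D₀ i) ((hD.inter (hT i).isOpen).mem_nhds ⟨hsD, hsD₀⟩)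
      obtain ⟨w, hwN, hwC⟩ := mem_closure_iff.1 (hDC hsD) N hNt.isOpen hsN
      obtain ⟨v, ⟨hvN, hvC⟩, hvC₀⟩ := mem_closure_iff.1 (hDC₀ (hN hwN).2) (N ∩ C)
        (hNt.isOpen.inter hC) ⟨hwN, hwC⟩
      obtain ⟨ε, hε⟩ := hNt.isSimplyConnected.isPathConnected.joinedIn _ hsN _ hvN
      obtain ⟨ζ, hζ⟩ := hCp.joinedIn _ hvC _ hu
      have hsub : ∀ t, γ.subpath (τ k) s t ∈ D₀ i := by
        intro t
        have : γ.subpath (τ k) s t ∈ range (γ.subpath (τ k) s) := ⟨t, rfl⟩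
        rw [Path.range_subpath_of_le _ _ _ hsk] at this
        obtain ⟨r, hr, hrt⟩ := this
        rw [← hrt]
        exact (hi ⟨hr.1, hr.2.trans hs⟩).1
      obtain ⟨p, hp, hph⟩ := ih (τ k) le_rfl (hT i).isOpen (hT i).isSimplyConnected hCD₀ hCS₀ hCo₀
        hDC₀ hCp₀ hvC₀ ((γ.subpath (τ k) s).trans ε) (fun t => by
          rw [Path.trans_apply]
          split_ifs
          exacts [hsub _, (hN (hε _)).2])
      refine ⟨p.trans ζ, fun t => ?_, ?_⟩
      · rw [Path.trans_apply]
        split_ifs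
        exacts [hp _, hCS (hζ _)]
      · have h1 : (ε.trans ζ).Homotopic δ := homotopic_of_forall_mem hDs _ _ (fun t => by
          rw [Path.trans_apply]
          split_ifs
          exacts [(hN (hε _)).1, hCD (hζ _)]) hδ
        have h2 : ((γ.subpath 0 (τ k)).trans (γ.subpath (τ k) s)).Homotopic (γ.subpath 0 s) :=
          ⟨Path.Homotopy.subpathTransSubpath γ 0 (τ k) s⟩
        rw [← Path.Homotopic.Quotient.eq] at *
        simp only [Path.Homotopic.Quotient.mk_trans] at *
        rw [hph, ← h1, ← h2]
        simp only [Path.Homotopic.Quotient.trans_assoc]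
  exact key m s ((hm m le_rfl).symm ▸ s.2.2) hD hDs hCD hCS hC hDC hCp hu δ hδ

/-- A path in `Y` between points of a tame open subset is homotopic to a path in the subset. -/
theorem IsTame.exists_path_homotopic {S : Set Y} (hS : IsTame S) (hSo : IsOpen S)
    {a b : Y} (ha : a ∈ S) (hb : b ∈ S) (γ : Path a b) :
    ∃ p : Path a b, (∀ t, p t ∈ S) ∧ p.Homotopic γ := by
  -- Taking `D ⊆ S` keeps the way back from the core to `b` inside `S`.
  obtain ⟨D, hDS, hbD, hD⟩ := hS b S (hSo.mem_nhds hb)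
  obtain ⟨C, hCD, hCS, hC, hDC, hCp⟩ := hD.exists_core
  obtain ⟨u, huC⟩ := hCp.nonempty
  obtain ⟨δ, hδ⟩ := hD.isSimplyConnected.isPathConnected.joinedIn _ hbD _ (hCD huC)
  obtain ⟨p, hp, hph⟩ := hS.exists_path_homotopic_subpath hSo ha γ 1 hD.isOpen hD.isSimplyConnected
    hCD hCS hC hDC hCp huC (δ.cast γ.target rfl) hδ
  refine ⟨(p.cast γ.source.symm rfl).trans δ.symm, fun t => ?_, ?_⟩
  · rw [Path.trans_apply]
    split_ifs
    exacts [hp _, hDS (hδ _)]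
  · have h2 : (p.cast γ.source.symm rfl).Homotopic (γ.trans δ) := by
      have := hph.pathCast γ.source.symm rfl
      rw [Path.subpath_zero_one] at this
      exact this
    rw [← Path.Homotopic.Quotient.eq] at *
    simp only [Path.Homotopic.Quotient.mk_trans, Path.Homotopic.Quotient.mk_symm] at *
    rw [h2]
    simp

/-- A space with a path connected tame subset is path connected. -/
theorem IsTame.pathConnectedSpace {S : Set Y} (hS : IsTame S) (h : IsPathConnected S) :
    PathConnectedSpace Y := by
  obtain ⟨a, ha⟩ := h.nonempty
  have key : ∀ y, Joined y a := fun y => by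
    obtain ⟨D, -, hyD, hD⟩ := hS y univ Filter.univ_mem
    obtain ⟨C, hCD, hCS, hC, hDC, hCp⟩ := hD.exists_core
    obtain ⟨u, huC⟩ := hCp.nonempty
    exact (hD.isSimplyConnected.isPathConnected.joinedIn _ hyD _ (hCD huC)).joined.trans
      (h.joinedIn _ (hCS huC) _ ha).joined
  exact ⟨⟨a⟩, fun x y => (key x).trans (key y).symm⟩

end Topology

/-! ### Fundamental groups -/

section FundamentalGroup

variable {X Y Z : Type*} [TopologicalSpace X] [TopologicalSpace Y] [TopologicalSpace Z]

/-- An open embedding with tame image induces a surjection on fundamental groups. -/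
theorem map_surjective_of_isTame (f : C(X, Y)) (hf : IsOpenEmbedding f) (hS : IsTame (range f))
    (x : X) : Function.Surjective (FundamentalGroup.map f x) := by
  intro c
  induction c using Path.Homotopic.Quotient.ind with
  | mk γ =>
  obtain ⟨p, hp, hph⟩ := hS.exists_path_homotopic hf.isOpen_range ⟨x, rfl⟩ ⟨x, rfl⟩ γ
  choose q hq using hp
  have hqc : Continuous q := hf.isInducing.continuous_iff.2 (by
    convert p.continuous using 1
    ext t
    exact hq t)
  let q' : Path x x := ⟨⟨q, hqc⟩, hf.injective (by simp [hq]), hf.injective (by simp [hq])⟩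
  refine ⟨Path.Homotopic.Quotient.mk q', ?_⟩
  have : q'.map f.continuous = p := by
    ext t
    exact hq t
  change Path.Homotopic.Quotient.mk (q'.map f.continuous) = _
  rw [this]
  exact Path.Homotopic.Quotient.eq.2 hph

/-- `Y` is path connected and its fundamental group is a quotient of `ℤⁿ`. -/
def IsQuotientOfLattice (n : ℕ) (Y : Type*) [TopologicalSpace Y] : Prop :=
  PathConnectedSpace Y ∧ ∃ (y : Y) (φ : Multiplicative (Fin n → ℤ) →* FundamentalGroup Y y),
    Function.Surjective φ

theorem IsQuotientOfLattice.exists_surjective {n : ℕ} (h : IsQuotientOfLattice n Y) (y : Y) :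
    ∃ φ : Multiplicative (Fin n → ℤ) →* FundamentalGroup Y y, Function.Surjective φ := by
  obtain ⟨h1, y', φ, hφ⟩ := h
  let e := FundamentalGroup.fundamentalGroupMulEquivOfPathConnected y' y
  exact ⟨e.toMonoidHom.comp φ, e.surjective.comp hφ⟩

theorem IsQuotientOfLattice.of_isTame {n : ℕ} (h : IsQuotientOfLattice n X) (f : C(X, Y))
    (hf : IsOpenEmbedding f) (hS : IsTame (range f)) : IsQuotientOfLattice n Y := by
  have := h.1
  obtain ⟨x, φ, hφ⟩ := h.2
  exact ⟨hS.pathConnectedSpace (isPathConnected_range f.continuous), f x,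
    (FundamentalGroup.map f x).comp φ, (map_surjective_of_isTame f hf hS x).comp hφ⟩

theorem IsQuotientOfLattice.of_subsingleton [Nonempty Y] [Subsingleton Y] :
    IsQuotientOfLattice 0 Y := by
  have hp : PathConnectedSpace Y :=
    ⟨inferInstance, fun x y => Subsingleton.elim x y ▸ Joined.refl x⟩
  have : SimplyConnectedSpace Y := simply_connected_iff_paths_homotopic'.2
    ⟨hp, fun p q => by rw [show p = q from Path.ext (Subsingleton.elim _ _)]⟩
  refine ⟨hp, Classical.arbitrary Y, 1, fun c => ⟨1, Subsingleton.elim _ _⟩⟩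

theorem map_inl_eq_prod (a : X) (b : Y) (α : FundamentalGroup X a) :
    FundamentalGroup.map (Y := X × Y) ⟨fun x => (x, b), by fun_prop⟩ a α =
      Path.Homotopic.prod α (Path.Homotopic.Quotient.refl b) := by
  induction α using Path.Homotopic.Quotient.ind
  rfl

theorem map_inr_eq_prod (a : X) (b : Y) (β : FundamentalGroup Y b) :
    FundamentalGroup.map (Y := X × Y) ⟨fun y => (a, y), by fun_prop⟩ b β =
      Path.Homotopic.prod (Path.Homotopic.Quotient.refl a) β := by
  induction β using Path.Homotopic.Quotient.ind
  rfl

/-- The fundamental group of `X × Y` is generated by the loops in the two slices. -/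
theorem exists_eq_mul_map_prod (a : X) (b : Y) (c : FundamentalGroup (X × Y) (a, b)) :
    ∃ (α : FundamentalGroup X a) (β : FundamentalGroup Y b),
      c = FundamentalGroup.map ⟨fun x => (x, b), by fun_prop⟩ a α *
        FundamentalGroup.map ⟨fun y => (a, y), by fun_prop⟩ b β := by
  refine ⟨Path.Homotopic.projLeft c, Path.Homotopic.projRight c, ?_⟩
  rw [map_inl_eq_prod, map_inr_eq_prod, FundamentalGroup.mul_def,
    Path.Homotopic.comp_prod_eq_prod_comp]
  simp

theorem commute_map_prod (a : X) (b : Y) (α : FundamentalGroup X a) (β : FundamentalGroup Y b) :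
    Commute (FundamentalGroup.map (Y := X × Y) ⟨fun x => (x, b), by fun_prop⟩ a α)
      (FundamentalGroup.map ⟨fun y => (a, y), by fun_prop⟩ b β) := by
  rw [map_inl_eq_prod, map_inr_eq_prod, Commute, SemiconjBy, FundamentalGroup.mul_def,
    FundamentalGroup.mul_def, Path.Homotopic.comp_prod_eq_prod_comp,
    Path.Homotopic.comp_prod_eq_prod_comp]
  simp

/-- If the fundamental group of `Y` is generated by that of `A × W` and the loops of the slice
`{a} × W` come from a space `V`, then it is generated by the images of those of `A` and `V`. -/
theorem IsQuotientOfLattice.of_slice {A W V : Type*} [TopologicalSpace A] [TopologicalSpace W]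
    [TopologicalSpace V] {n : ℕ} (hA : IsQuotientOfLattice 1 A) (hV : IsQuotientOfLattice n V)
    [PathConnectedSpace Y] (i : C(W, V)) (e : C(A × W, Y)) (sec : C(V, Y)) (a : A) (w : W)
    (hi : Function.Surjective (FundamentalGroup.map i w))
    (he : Function.Surjective (FundamentalGroup.map e (a, w)))
    (hsec : ∀ w', sec (i w') = e (a, w')) : IsQuotientOfLattice (n + 1) Y := by
  obtain ⟨φA, hφA⟩ := hA.exists_surjective a
  obtain ⟨φV, hφV⟩ := hV.exists_surjective (i w)
  let K : FundamentalGroup A a →* FundamentalGroup Y (e (a, w)) :=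
    (FundamentalGroup.map e (a, w)).comp
      (FundamentalGroup.map (Y := A × W) ⟨fun x => (x, w), by fun_prop⟩ a)
  let F : FundamentalGroup V (i w) →* FundamentalGroup Y (e (a, w)) :=
    FundamentalGroup.mapOfEq sec (hsec w)
  have hF : ∀ β : FundamentalGroup W w, F (FundamentalGroup.map i w β) =
      FundamentalGroup.map e (a, w)
        (FundamentalGroup.map (Y := A × W) ⟨fun y => (a, y), by fun_prop⟩ w β) := by
    intro β
    simp only [F]
    rw [FundamentalGroup.mapOfEq_apply]
    induction β using Path.Homotopic.Quotient.ind with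
    | mk γ =>
    refine congrArg Path.Homotopic.Quotient.mk (Path.ext (funext fun t => ?_))
    exact hsec (γ t)
  -- By `hi` a loop of `V` comes from a loop of `W`, whose image in `Y` also comes from the slice
  -- `{a} × W`. There it commutes with the loops of `A`.
  have hcomm : ∀ α v, Commute (K α) (F v) := by
    intro α v
    obtain ⟨β, rfl⟩ := hi v
    rw [hF]
    exact (commute_map_prod a w α β).map (FundamentalGroup.map e (a, w))
  let pr : Multiplicative (Fin (n + 1) → ℤ) →*
      Multiplicative (Fin 1 → ℤ) × Multiplicative (Fin n → ℤ) :=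
    MonoidHom.prod
      (AddMonoidHom.toMultiplicative
        ⟨⟨fun x _ => x 0, by ext; simp⟩, fun x y => by ext; simp⟩)
      (AddMonoidHom.toMultiplicative
        ⟨⟨fun x j => x j.succ, by ext; simp⟩, fun x y => by ext; simp⟩)
  refine ⟨inferInstance, e (a, w),
    (MonoidHom.noncommCoprod (K.comp φA) (F.comp φV) (fun x y => hcomm _ _)).comp pr, fun c => ?_⟩
  obtain ⟨c, rfl⟩ := he c
  obtain ⟨α, β, rfl⟩ := exists_eq_mul_map_prod a w c
  obtain ⟨x, hx⟩ := hφA α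
  obtain ⟨y, hy⟩ := hφV (FundamentalGroup.map i w β)
  refine ⟨Multiplicative.ofAdd (Fin.cons (x.toAdd 0) y.toAdd), ?_⟩
  have h1 : pr (Multiplicative.ofAdd (Fin.cons (x.toAdd 0) y.toAdd)) = (x, y) := by
    ext j
    · fin_cases j
      rfl
    · rfl
  rw [MonoidHom.comp_apply, h1, MonoidHom.noncommCoprod_apply, map_mul]
  change K (φA x) * F (φV y) = _
  rw [hx, hy, hF]
  rfl

end FundamentalGroup

end ClusterType

end

/-! ### Complements of hypersurfaces in complex affine space. -/

noncomputable section

namespace ClusterType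

open Set Topology unitInterval

section Polynomial

variable {κ : Type*}

theorem isOpen_eval_ne_zero (p : MvPolynomial κ ℂ) : IsOpen {x | MvPolynomial.eval x p ≠ 0} :=
  isOpen_ne_fun (MvPolynomial.continuous_eval p) continuous_const

/-- The restriction of a polynomial to a complex line. -/
theorem exists_polynomial_eval_line (p : MvPolynomial κ ℂ) (a b : κ → ℂ) :
    ∃ q : Polynomial ℂ, ∀ z, q.eval z = MvPolynomial.eval (fun i => a i + z * b i) p := by
  refine ⟨MvPolynomial.aeval (fun i => Polynomial.C (a i) + Polynomial.X * Polynomial.C (b i)) p,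
    fun z => ?_⟩
  rw [← Polynomial.coe_evalRingHom, MvPolynomial.aeval_def, MvPolynomial.hom_eval₂,
    MvPolynomial.eval, MvPolynomial.coe_eval₂Hom]
  congr 1
  · ext
    simp
  · ext i
    simp
    ring

variable [Finite κ]

/-- A ball of the sup norm is a product of discs, and a polynomial vanishing on a product of
infinite sets is zero. -/
theorem exists_eval_ne_zero_of_isOpen {p : MvPolynomial κ ℂ} (hp : p ≠ 0) {D : Set (κ → ℂ)}
    (hD : IsOpen D) (hne : D.Nonempty) : ∃ x ∈ D, MvPolynomial.eval x p ≠ 0 := by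
  have := Fintype.ofFinite κ
  by_contra! h
  obtain ⟨x, hx⟩ := hne
  obtain ⟨ε, hε, hsub⟩ := Metric.isOpen_iff.1 hD x hx
  refine hp (MvPolynomial.funext_set (fun i => Metric.ball (x i) ε) (fun i => ?_) fun y hy => ?_)
  · exact infinite_of_mem_nhds (x i) (Metric.ball_mem_nhds _ hε)
  · rw [map_zero]
    refine h y (hsub ?_)
    rw [ball_pi _ hε]
    exact hy

theorem subset_closure_eval_ne_zero {p : MvPolynomial κ ℂ} (hp : p ≠ 0) {D : Set (κ → ℂ)}
    (hD : IsOpen D) : D ⊆ closure (D ∩ {x | MvPolynomial.eval x p ≠ 0}) := by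
  intro x hx
  rw [mem_closure_iff]
  intro o ho hxo
  obtain ⟨y, hy, hy'⟩ := exists_eval_ne_zero_of_isOpen hp (ho.inter hD) ⟨x, hxo, hx⟩
  exact ⟨y, hy.1, hy.2, hy'⟩

/-- The complement of a hypersurface in a convex open set is path connected. -/
theorem isPathConnected_inter_eval_ne_zero {p : MvPolynomial κ ℂ} (hp : p ≠ 0) {D : Set (κ → ℂ)}
    (hD : IsOpen D) (hc : Convex ℝ D) (hne : D.Nonempty) :
    IsPathConnected (D ∩ {x | MvPolynomial.eval x p ≠ 0}) := by
  have := Fintype.ofFinite κ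
  obtain ⟨x₀, hx₀, hx₀'⟩ := exists_eval_ne_zero_of_isOpen hp hD hne
  rw [isPathConnected_iff]
  refine ⟨⟨x₀, hx₀, hx₀'⟩, ?_⟩
  rintro a ⟨haD, ha⟩ b ⟨hbD, hb⟩
  obtain ⟨q, hq⟩ := exists_polynomial_eval_line p a (b - a)
  have hq0 : q.eval 0 ≠ 0 := by rw [hq]; simpa using ha
  have hq1 : q.eval 1 ≠ 0 := by rw [hq]; simpa using hb
  have hqne : q ≠ 0 := by rintro rfl; simp at hq0
  -- the bad slopes form a finite set
  have hfin : ((fun r : ℂ => r.im / (r.re * (1 - r.re))) '' {r | q.IsRoot r}).Finite :=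
    (Polynomial.finite_setOfPred_isRoot hqne).image _
  have hcont : Continuous fun s : ℝ => b + (Complex.I * (s : ℂ)) • (b - a) := by fun_prop
  -- This keeps the arc below inside `D`: its point at time `t` is the convex combination, with
  -- weights `1 - t` and `t`, of `a` and `b + i s (1 - t) (b - a)`.
  have h0 : ∀ᶠ s : ℝ in 𝓝 0, ∀ c ∈ Icc (0 : ℝ) 1,
      b + (Complex.I * ((s * c : ℝ) : ℂ)) • (b - a) ∈ D := by
    have h1 : ∀ᶠ s : ℝ in 𝓝 0, b + (Complex.I * (s : ℂ)) • (b - a) ∈ D :=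
      hcont.continuousAt.eventually_mem (hD.mem_nhds (by simpa using hbD))
    obtain ⟨ε, hε, hsub⟩ := Metric.eventually_nhds_iff.1 h1
    refine Metric.eventually_nhds_iff.2 ⟨ε, hε, fun s hs c hc => hsub ?_⟩
    rw [Real.dist_eq, sub_zero] at *
    rw [abs_mul, abs_of_nonneg hc.1]
    exact (mul_le_of_le_one_right (abs_nonneg _) hc.2).trans_lt hs
  obtain ⟨s, hsD, hsbad⟩ : ∃ s : ℝ, (∀ c ∈ Icc (0 : ℝ) 1,
      b + (Complex.I * ((s * c : ℝ) : ℂ)) • (b - a) ∈ D) ∧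
      s ∉ ((fun r : ℂ => r.im / (r.re * (1 - r.re))) '' {r | q.IsRoot r}) := by
    obtain ⟨s, hs, hs'⟩ := ((infinite_of_mem_nhds (0 : ℝ) h0).sdiff hfin).nonempty
    exact ⟨s, hs, hs'⟩
  -- A parabolic arc from `0` to `1` in the parameter plane of the complex line through `a` and `b`.
  -- A root of `q` in its interior determines `s`, and these values were excluded.
  let z : ℝ → ℂ := fun t => t + Complex.I * ((s * (t * (1 - t)) : ℝ) : ℂ)
  have hz : Continuous z := by fun_prop
  refine JoinedIn.ofLine (f := fun t => fun i => a i + z t * (b - a) i) ?_ ?_ ?_ ?_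
  · exact Continuous.continuousOn (by fun_prop)
  · simp [z]
  · simp [z]
  · rintro _ ⟨t, ht, rfl⟩
    refine ⟨?_, ?_⟩
    · have := hc haD (hsD (1 - t) ⟨by linarith [ht.2], by linarith [ht.1]⟩)
        (show (0 : ℝ) ≤ 1 - t by linarith [ht.2]) ht.1 (by ring)
      convert this using 1
      ext i
      simp [z]
      ring
    · change MvPolynomial.eval _ p ≠ 0
      rw [← hq]
      intro hroot
      have hre : (z t).re = t := by simp [z]
      have him : (z t).im = s * (t * (1 - t)) := by simp [z, -Complex.ofReal_mul]
      have ht0 : t ≠ 0 := by rintro rfl; exact hq0 (by simpa [z] using hroot)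
      have ht1 : 1 - t ≠ 0 := by
        intro h
        obtain rfl : t = 1 := by linarith
        exact hq1 (by simpa [z] using hroot)
      refine hsbad ⟨z t, hroot, ?_⟩
      simp only [hre, him]
      field_simp

end Polynomial

/-! ### Tameness from local coordinates. -/

section Tame

variable {Y : Type*} [TopologicalSpace Y]

/-- If `Y` has local coordinates in which `S` contains the complement of a hypersurface,
then `S` is tame. -/
theorem isTame_of_charts {S : Set Y}
    (h : ∀ y : Y, ∃ (κ : Type) (_ : Finite κ) (e : OpenPartialHomeomorph Y (κ → ℂ))
      (p : MvPolynomial κ ℂ), y ∈ e.source ∧ p ≠ 0 ∧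
        ∀ x ∈ e.source, MvPolynomial.eval (e x) p ≠ 0 → x ∈ S) : IsTame S := by
  intro y N hN
  obtain ⟨κ, _, e, p, hy, hp, hS⟩ := h y
  have := Fintype.ofFinite κ
  have hmem : e.target ∩ e.symm ⁻¹' N ∈ 𝓝 (e y) := by
    refine Filter.inter_mem (e.open_target.mem_nhds (e.map_source hy)) ?_
    refine (e.continuousAt_symm (e.map_source hy)).preimage_mem_nhds ?_
    rwa [e.left_inv hy]
  obtain ⟨r, hr, hsub⟩ := Metric.mem_nhds_iff.1 hmem
  set B := Metric.ball (e y) r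
  have hBt : B ⊆ e.target := fun x hx => (hsub hx).1
  have hBne : B.Nonempty := ⟨_, Metric.mem_ball_self hr⟩
  have hBo : IsOpen B := Metric.isOpen_ball
  have hcont : ContinuousOn e.symm B := e.continuousOn_symm.mono hBt
  have hopen : ∀ s ⊆ B, IsOpen s → IsOpen (e.symm '' s) := fun s hs hso =>
    e.symm.isOpen_image_of_subset_source hso (hs.trans hBt)
  refine ⟨e.symm '' B, ?_, ⟨e y, Metric.mem_ball_self hr, e.left_inv hy⟩, ?_, ?_,
    e.symm '' (B ∩ {x | MvPolynomial.eval x p ≠ 0}), image_mono inter_subset_left, ?_, ?_, ?_, ?_⟩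
  · rintro _ ⟨x, hx, rfl⟩
    exact (hsub hx).2
  · exact hopen B le_rfl hBo
  · have : ContractibleSpace B := (convex_ball (e y) r).contractibleSpace hBne
    have hs : SimplyConnectedSpace B := inferInstance
    let φ : B ≃ₜ (e.symm '' B : Set Y) := e.symm.homeomorphOfImageSubsetSource hBt rfl
    exact φ.symm.toHomotopyEquiv.simplyConnectedSpace
  · rintro _ ⟨x, ⟨hx, hx'⟩, rfl⟩
    refine hS _ (e.map_target (hBt hx)) ?_
    rwa [e.right_inv (hBt hx)]
  · exact hopen _ inter_subset_left (hBo.inter (isOpen_eval_ne_zero p))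
  · rintro _ ⟨x, hx, rfl⟩
    exact ((hcont x hx).mono inter_subset_left).mem_closure_image
      (subset_closure_eval_ne_zero hp hBo hx)
  · exact (isPathConnected_inter_eval_ne_zero hp hBo (convex_ball _ _) hBne).image'
      (hcont.mono inter_subset_left)

/-- The complement of a hypersurface is tame in every open subset of `ℂᵈ`. -/
theorem isTame_eval_ne_zero {κ : Type} [Finite κ] {O : Set (κ → ℂ)} (hO : IsOpen O)
    {p : MvPolynomial κ ℂ} (hp : p ≠ 0) : IsTame {y : O | MvPolynomial.eval (y : κ → ℂ) p ≠ 0} := by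
  refine isTame_of_charts fun y => ?_
  have : Nonempty O := ⟨y⟩
  exact ⟨κ, inferInstance, hO.isOpenEmbedding_subtypeVal.toOpenPartialHomeomorph _, p,
    trivial, hp, fun x _ hx => hx⟩

end Tame

/-- The fundamental group of `ℂˣ` is a quotient of `ℤ`. -/
theorem isQuotientOfLattice_punctured : IsQuotientOfLattice 1 {z : ℂ // z ≠ 0} := by
  let E : C(ℂ, {z : ℂ // z ≠ 0}) := ⟨fun z => ⟨_, z.exp_ne_zero⟩, by fun_prop⟩
  have cov : IsCoveringMap E := Complex.isCoveringMap_exp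
  have hsurj : Function.Surjective E := fun z => ⟨Complex.log z, Subtype.ext (Complex.exp_log z.2)⟩
  have hper : ∀ (z : ℂ) (k : ℤ), E (z + k * (2 * Real.pi * Complex.I)) = E z := fun z k =>
    Subtype.ext (Complex.exp_eq_exp_iff_exists_int.2 ⟨k, rfl⟩)
  have hpc : PathConnectedSpace {z : ℂ // z ≠ 0} := hsurj.pathConnectedSpace E.continuous
  let c : ℤ → ℂ := fun k => k * (2 * Real.pi * Complex.I)
  have hc0 : ∀ k, E (c k) = E 0 := fun k => by simpa using hper 0 k
  -- the class of a path from `x` to `y` in `ℂ`, as a loop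
  let cl : ∀ {x y : ℂ}, Path x y → (hx : E x = E 0) → (hy : E y = E 0) →
    FundamentalGroup _ (E 0) := fun p hx hy => Path.Homotopic.Quotient.mk
      ((p.map E.continuous).cast hx.symm hy.symm)
  have hcl : ∀ {x y : ℂ} (p q : Path x y) (hx : E x = E 0) (hy : E y = E 0),
      cl p hx hy = cl q hx hy := fun p q hx hy => Path.Homotopic.Quotient.eq.2
    (((SimplyConnectedSpace.paths_homotopic p q).map E).pathCast hx.symm hy.symm)
  have hshift : ∀ k l : ℤ, c (k + l) = c l + c k := fun k l => by
    simp only [c]; push_cast; ring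
  let L : ∀ x y : ℂ, Path x y := fun x y => PathConnectedSpace.somePath x y
  -- Multiplicativity: translating the path for `k` by the period `c l` does not change its image
  -- under `E`, so it can be appended to the path for `l`. The result has the end points of the path
  -- for `k + l`, and `ℂ` is simply connected.
  let φ : Multiplicative (Fin 1 → ℤ) →* FundamentalGroup _ (E 0) := MonoidHom.mk'
    (fun k => cl (L 0 (c (k.toAdd 0))) rfl (hc0 _)) (fun k l => by
      rw [FundamentalGroup.mul_def]
      have h1 : cl (L 0 (c (k.toAdd 0))) rfl (hc0 _) =
          cl (((L 0 (c (k.toAdd 0))).map (continuous_const_add (c (l.toAdd 0)))).cast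
            (add_zero _).symm (hshift _ _)) (hc0 _) (hc0 _) := by
        refine congrArg Path.Homotopic.Quotient.mk (Path.ext (funext fun t => ?_))
        simp only [Path.cast_coe, Path.map_coe, Function.comp]
        rw [add_comm]
        exact (hper _ _).symm
      rw [h1]
      change _ = Path.Homotopic.Quotient.trans (Path.Homotopic.Quotient.mk _)
        (Path.Homotopic.Quotient.mk _)
      rw [← Path.Homotopic.Quotient.mk_trans]
      refine (hcl _ ((L 0 (c (l.toAdd 0))).trans
        (((L 0 (c (k.toAdd 0))).map (continuous_const_add (c (l.toAdd 0)))).cast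
            (add_zero _).symm (hshift _ _))) rfl (hc0 _)).trans ?_
      refine congrArg Path.Homotopic.Quotient.mk (Path.ext (funext fun t => ?_))
      simp only [Path.cast_coe, Path.map_coe, Function.comp, Path.trans_apply]
      split_ifs <;> rfl)
  refine ⟨hpc, E 0, φ, fun d => ?_⟩
  induction d using Path.Homotopic.Quotient.ind with
  | mk γ =>
  -- The lift from `0` of a loop ends at a period of the exponential.
  obtain ⟨Γ, hΓ, hΓ0⟩ := cov.exists_path_lifts γ.toContinuousMap 0 (by simp)
  have h1 : E (Γ 1) = E 0 := by
    have := congrFun hΓ 1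
    simpa using this
  obtain ⟨k, hk⟩ := Complex.exp_eq_exp_iff_exists_int.1 (congrArg Subtype.val h1)
  rw [zero_add] at hk
  let p : Path (0 : ℂ) (c k) := ⟨Γ, hΓ0, hk⟩
  refine ⟨Multiplicative.ofAdd fun _ => k, (hcl _ p rfl (hc0 k)).trans ?_⟩
  refine congrArg Path.Homotopic.Quotient.mk (Path.ext (funext fun t => ?_))
  exact congrFun hΓ t

end ClusterType

end

/-! ### Elimination of a variable and specialization at a general constant. -/

noncomputable section

namespace ClusterType

open Set Topology

section Elimination

open Polynomial

/-- Elimination of a variable from two relatively prime polynomials. -/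
theorem exists_C_eq_of_isRelPrime {R : Type*} [CommRing R] [IsDomain R]
    [UniqueFactorizationMonoid R] {F G : R[X]} (h : IsRelPrime F G) :
    ∃ r : R, r ≠ 0 ∧ ∃ a b : R[X], C r = a * F + b * G := by
  classical
  let := Classical.choice (inferInstance : Nonempty (NormalizedGCDMonoid R))
  let K := FractionRing R
  let ι : R[X] →+* K[X] := mapRingHom (algebraMap R K)
  have hinj : Function.Injective (algebraMap R K) := IsFractionRing.injective R K
  -- Gauss's lemma: a nonzero common divisor over `K` is associated to a primitive polynomial over
  -- `R`, which already divides `F` and `G` over `R`.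
  have key : IsRelPrime (F.map (algebraMap R K)) (G.map (algebraMap R K)) := by
    intro d hdF hdG
    by_cases hd0 : d = 0
    · subst hd0
      rw [zero_dvd_iff, Polynomial.map_eq_zero_iff hinj] at hdF hdG
      subst hdF hdG
      exact absurd (h (dvd_refl 0) (dvd_refl 0)) not_isUnit_zero
    let d' := IsLocalization.integerNormalization (nonZeroDivisors R) d
    obtain ⟨b, hb, hd'⟩ := IsLocalization.integerNormalization_spec (nonZeroDivisors R) d
    have hb0 : algebraMap R K b ≠ 0 := by
      simpa using nonZeroDivisors.ne_zero hb
    have hd'0 : d' ≠ 0 := by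
      intro h0
      rw [show IsLocalization.integerNormalization (nonZeroDivisors R) d = 0 from h0,
        Polynomial.map_zero, eq_comm, ← algebraMap_smul K b d, smul_eq_zero] at hd'
      exact hd'.elim hb0 hd0
    have hc0 : algebraMap R K d'.content ≠ 0 := by
      simpa [content_eq_zero_iff] using hd'0
    have hassoc : Associated (d'.primPart.map (algebraMap R K)) d := by
      have h1 : C (algebraMap R K d'.content) * d'.primPart.map (algebraMap R K) =
          C (algebraMap R K b) * d := by
        rw [← Polynomial.map_C, ← Polynomial.map_mul, ← eq_C_content_mul_primPart]
        rw [show d'.map (algebraMap R K) = b • d from hd', ← algebraMap_smul K b d,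
          Polynomial.smul_eq_C_mul]
      have hu1 : IsUnit (C (algebraMap R K d'.content)) := isUnit_C.2 hc0.isUnit
      have hu2 : IsUnit (C (algebraMap R K b)) := isUnit_C.2 hb0.isUnit
      exact ((associated_isUnit_mul_left_iff hu1).2 (Associated.refl _)).symm.trans
        ((Associated.of_eq h1).trans ((associated_isUnit_mul_left_iff hu2).2 (Associated.refl _)))
    have hdvd : ∀ H : R[X], d ∣ H.map (algebraMap R K) → d'.primPart ∣ H := fun H hH =>
      (isPrimitive_primPart d').dvd_of_fraction_map_dvd_fraction_map (K := K) (hassoc.dvd.trans hH)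
    have hu := h (hdvd F hdF) (hdvd G hdG)
    exact hassoc.isUnit (hu.map ι)
  -- Over the field `K` relatively prime polynomials satisfy a Bézout identity; clearing the
  -- denominators `r` and `s` of its coefficients leaves the constant `r * s`.
  obtain ⟨a, b, hab⟩ := key.isCoprime
  obtain ⟨r, hr, har⟩ := IsLocalization.integerNormalization_spec (nonZeroDivisors R) a
  obtain ⟨s, hs, hbs⟩ := IsLocalization.integerNormalization_spec (nonZeroDivisors R) b
  set a' := IsLocalization.integerNormalization (nonZeroDivisors R) a
  set b' := IsLocalization.integerNormalization (nonZeroDivisors R) b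
  refine ⟨r * s, mul_ne_zero (nonZeroDivisors.ne_zero hr) (nonZeroDivisors.ne_zero hs),
    C s * a', C r * b', Polynomial.map_injective _ hinj ?_⟩
  simp only [Polynomial.map_add, Polynomial.map_mul, Polynomial.map_C, har, hbs]
  rw [← algebraMap_smul K r a, ← algebraMap_smul K s b, Polynomial.smul_eq_C_mul,
    Polynomial.smul_eq_C_mul, map_mul, C_mul]
  linear_combination (-C (algebraMap R K r) * C (algebraMap R K s)) * hab

/-- For an element `r` and finitely many elements with a nontrivial condition on each prime factor:
all but finitely many constants satisfy a condition which for each prime fails finitely often. -/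
theorem exists_forall_prime_dvd {k R : Type*} [Field k] [Infinite k] [CommRing R] [IsDomain R]
    [UniqueFactorizationMonoid R] {r : R} (hr : r ≠ 0) (Q : R → k → Prop)
    (hQ : ∀ q q', Associated q q' → ∀ t, Q q t → Q q' t)
    (h : ∀ q, Prime q → q ∣ r → {t | ¬ Q q t}.Finite) :
    ∃ t : k, t ≠ 0 ∧ ∀ q, Prime q → q ∣ r → Q q t := by
  classical
  let s := (UniqueFactorizationMonoid.factors r).toFinset
  have hfin : ((⋃ q ∈ s, {t | ¬ Q q t}) ∪ {0}).Finite := by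
    refine Set.Finite.union (Set.Finite.biUnion s.finite_toSet fun q hq => ?_)
      (Set.finite_singleton 0)
    have hq' : q ∈ UniqueFactorizationMonoid.factors r := by simpa [s] using hq
    exact h q (UniqueFactorizationMonoid.prime_of_factor q hq')
      (UniqueFactorizationMonoid.dvd_of_mem_factors hq')
  obtain ⟨t, ht⟩ := hfin.exists_notMem
  simp only [mem_union, mem_iUnion, mem_singleton_iff, not_or, not_exists] at ht
  refine ⟨t, ht.2, fun q hq hqr => ?_⟩
  obtain ⟨q', hq', hass⟩ := UniqueFactorizationMonoid.exists_mem_factors_of_dvd hr hq.irreducible hqr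
  have := ht.1 q' (by simpa [s] using hq')
  exact hQ q' q hass.symm t (not_not.1 this)

variable {k R : Type*} [Field k] [CommRing R] [Algebra k R]

/-- A polynomial which is not divisible by the prime `q` remains so under the specialization of
the variable to all but finitely many constants. -/
theorem finite_setOf_dvd_eval {q : R} (hq : Prime q) {F : R[X]} (hF : ¬ C q ∣ F) :
    {t : k | q ∣ F.eval (algebraMap k R t)}.Finite := by
  have hprime : (Ideal.span {q}).IsPrime := (Ideal.span_singleton_prime hq.ne_zero).2 hq
  -- Modulo `q` the polynomial stays nonzero over a domain into which `k` embeds, and the bad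
  -- constants become its roots.
  let π := Ideal.Quotient.mk (Ideal.span {q})
  have hne : F.map π ≠ 0 := by
    intro h0
    refine hF (C_dvd_iff_dvd_coeff _ _ |>.2 fun i => ?_)
    have := congrArg (fun p => p.coeff i) h0
    simpa [π, Ideal.Quotient.eq_zero_iff_mem, Ideal.mem_span_singleton] using this
  have hinj : Function.Injective (π.comp (algebraMap k R)) := RingHom.injective _
  refine Set.Finite.of_finite_image (f := π.comp (algebraMap k R)) ?_ hinj.injOn
  refine (Polynomial.finite_setOfPred_isRoot hne).subset ?_
  rintro _ ⟨t, ht, rfl⟩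
  change Polynomial.eval _ _ = 0
  rw [Polynomial.eval_map, RingHom.comp_apply, Polynomial.eval₂_at_apply]
  exact Ideal.Quotient.eq_zero_iff_mem.2 (Ideal.mem_span_singleton.2 ht)

/-- If `q` divides `a` and `b` not simultaneously, it divides at most one `a + t b`. -/
theorem finite_setOf_dvd_add {q a b : R} (hq : Prime q) (h : ¬ (q ∣ a ∧ q ∣ b)) :
    {t : k | q ∣ a + b * algebraMap k R t}.Finite := by
  have : ¬ C q ∣ C a + C b * Polynomial.X := by
    rw [C_dvd_iff_dvd_coeff]
    intro hd
    exact h ⟨by simpa using hd 0, by simpa using hd 1⟩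
  simpa using finite_setOf_dvd_eval (k := k) hq this

/-- Elimination and specialization: two relatively prime polynomials over `R` give a nonzero
element `r` in the ideal they generate and a combination of their values at a nonzero constant
which is relatively prime to `r`. -/
theorem exists_specialization [Infinite k] [IsDomain R] [UniqueFactorizationMonoid R] {F G : R[X]}
    (h : IsRelPrime F G) :
    ∃ r : R, r ≠ 0 ∧ (∃ a b : R[X], C r = a * F + b * G) ∧ ∃ t c : k, t ≠ 0 ∧
      IsRelPrime r (F.eval (algebraMap k R t) + G.eval (algebraMap k R t) * algebraMap k R c) := by
  obtain ⟨r, hr, hab⟩ := exists_C_eq_of_isRelPrime h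
  -- A prime `q` of `R` cannot divide both `F` and `G`, so it divides both values for only finitely
  -- many `t`. This makes the choice of `c` possible.
  obtain ⟨t, ht, htq⟩ := exists_forall_prime_dvd (k := k) hr
    (fun q t => ¬ (q ∣ F.eval (algebraMap k R t) ∧ q ∣ G.eval (algebraMap k R t)))
    (fun q q' hqq' t hQ => by simpa [hqq'.dvd_iff_dvd_left] using hQ)
    (fun q hq _ => by
      by_cases hF : C q ∣ F
      · have hG : ¬ C q ∣ G := fun hG => hq.not_isUnit (isUnit_C.1 (h hF hG))
        exact (finite_setOf_dvd_eval (k := k) hq hG).subset fun t ht => (not_not.1 ht).2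
      · exact (finite_setOf_dvd_eval (k := k) hq hF).subset fun t ht => (not_not.1 ht).1)
  obtain ⟨c, -, hcq⟩ := exists_forall_prime_dvd (k := k) hr
    (fun q c => ¬ q ∣ F.eval (algebraMap k R t) + G.eval (algebraMap k R t) * algebraMap k R c)
    (fun q q' hqq' c hQ => by simpa [hqq'.dvd_iff_dvd_left] using hQ)
    (fun q hq hqr => by simpa using finite_setOf_dvd_add hq (htq q hq hqr))
  refine ⟨r, hr, hab, t, c, ht, ?_⟩
  rw [UniqueFactorizationMonoid.isRelPrime_iff_no_prime_factors hr]
  exact fun d hd hd' hp => hcq d hp hd hd'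

end Elimination

/-! ### The fundamental group of the torus minus a codimension two subset. -/

/-- The complement in the complex torus of the common zeros of two polynomials. -/
def torusCompl {n : ℕ} (f g : MvPolynomial (Fin n) ℂ) : Set (Fin n → ℂ) :=
  {x | (∀ i, x i ≠ 0) ∧ (MvPolynomial.eval x f ≠ 0 ∨ MvPolynomial.eval x g ≠ 0)}

theorem isOpen_torusCompl {n : ℕ} (f g : MvPolynomial (Fin n) ℂ) : IsOpen (torusCompl f g) := by
  have h1 : IsOpen {x : Fin n → ℂ | ∀ i, x i ≠ 0} := by
    rw [Set.ofPred_forall]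
    exact isOpen_iInter_of_finite fun i => isOpen_ne_fun (continuous_apply i) continuous_const
  exact h1.inter ((isOpen_eval_ne_zero f).union (isOpen_eval_ne_zero g))

/-- With `g = 0` the space is the complement of one hypersurface in `ℂⁿ`, so the results on such
complements apply. -/
theorem torusCompl_zero_right {n : ℕ} (f : MvPolynomial (Fin n) ℂ) :
    torusCompl f 0 = univ ∩ {x | MvPolynomial.eval x (f * ∏ i, MvPolynomial.X i) ≠ 0} := by
  ext x
  simp [torusCompl, Finset.prod_eq_zero_iff, and_comm]

theorem isPathConnected_torusCompl_zero {n : ℕ} {f : MvPolynomial (Fin n) ℂ} (hf : f ≠ 0) :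
    IsPathConnected (torusCompl f 0) := by
  rw [torusCompl_zero_right]
  exact isPathConnected_inter_eval_ne_zero
    (mul_ne_zero hf (Finset.prod_ne_zero_iff.2 fun i _ => MvPolynomial.X_ne_zero i))
    isOpen_univ convex_univ univ_nonempty

theorem eval_cons {n : ℕ} (f : MvPolynomial (Fin (n + 1)) ℂ) (t : ℂ) (v : Fin n → ℂ) :
    MvPolynomial.eval (Fin.cons t v : Fin (n + 1) → ℂ) f = MvPolynomial.eval v
      ((MvPolynomial.finSuccEquiv ℂ n f).eval (algebraMap ℂ (MvPolynomial (Fin n) ℂ) t)) := by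
  rw [MvPolynomial.eval_eq_eval_mv_eval', Polynomial.eval_map, Polynomial.eval,
    Polynomial.hom_eval₂]
  simp [MvPolynomial.algebraMap_eq]

/-- The complement in the torus of a closed subset of codimension two has abelian fundamental
group, generated by `n` elements. -/
theorem isQuotientOfLattice_torusCompl {n : ℕ} (f g : MvPolynomial (Fin n) ℂ)
    (h : IsRelPrime f g) : IsQuotientOfLattice n (torusCompl f g) := by
  induction n with
  | zero =>
    have : Nonempty (torusCompl f g) := by
      -- In dimension zero the torus is a point; if it were removed, both polynomials would be zero
      -- and hence not relatively prime.
      by_contra hne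
      have hz : ∀ x, MvPolynomial.eval x f = 0 ∧ MvPolynomial.eval x g = 0 := by
        intro x
        by_contra hx
        exact hne ⟨x, fun i => i.elim0, by tauto⟩
      obtain rfl : f = 0 := MvPolynomial.funext fun x => by simp [(hz x).1]
      obtain rfl : g = 0 := MvPolynomial.funext fun x => by simp [(hz x).2]
      exact not_isUnit_zero (h (dvd_refl 0) (dvd_refl 0))
    exact IsQuotientOfLattice.of_subsingleton
  | succ n ih =>
    let E := MvPolynomial.finSuccEquiv ℂ n
    have hE : IsRelPrime (E f) (E g) := by
      intro d hf hg
      have := h (d := E.symm d) (by simpa using map_dvd E.symm hf) (by simpa using map_dvd E.symm hg)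
      simpa using this.map E
    obtain ⟨r, hr, ⟨a, b, hab⟩, t, c, ht, hrel⟩ := exists_specialization (k := ℂ) hE
    set k := (E f).eval (algebraMap ℂ (MvPolynomial (Fin n) ℂ) t) +
      (E g).eval (algebraMap ℂ (MvPolynomial (Fin n) ℂ) t) *
        algebraMap ℂ (MvPolynomial (Fin n) ℂ) c
    have hr_mem : ∀ (z : ℂ) (v : Fin n → ℂ), MvPolynomial.eval v r ≠ 0 →
        MvPolynomial.eval (Fin.cons z v : Fin (n + 1) → ℂ) f ≠ 0 ∨
        MvPolynomial.eval (Fin.cons z v : Fin (n + 1) → ℂ) g ≠ 0 := by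
      intro z v hv
      by_contra! hcon
      rw [eval_cons, eval_cons] at hcon
      have h1 := congrArg (fun p => MvPolynomial.eval v
        (Polynomial.eval (algebraMap ℂ (MvPolynomial (Fin n) ℂ) z) p)) hab
      simp only [Polynomial.eval_C, Polynomial.eval_add, Polynomial.eval_mul, map_add, map_mul] at h1
      rw [show E f = MvPolynomial.finSuccEquiv ℂ n f from rfl,
        show E g = MvPolynomial.finSuccEquiv ℂ n g from rfl, hcon.1, hcon.2] at h1
      simp at h1
      exact hv h1
    have hk_mem : ∀ v : Fin n → ℂ, MvPolynomial.eval v k ≠ 0 →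
        MvPolynomial.eval (Fin.cons t v : Fin (n + 1) → ℂ) f ≠ 0 ∨
        MvPolynomial.eval (Fin.cons t v : Fin (n + 1) → ℂ) g ≠ 0 := by
      intro v hv
      by_contra! hcon
      rw [eval_cons, eval_cons] at hcon
      refine hv ?_
      simp only [k, map_add, map_mul]
      rw [show E f = MvPolynomial.finSuccEquiv ℂ n f from rfl,
        show E g = MvPolynomial.finSuccEquiv ℂ n g from rfl, hcon.1, hcon.2]
      simp
    have hcons : ∀ (z : ℂ) (v : Fin n → ℂ), z ≠ 0 → (∀ i, v i ≠ 0) →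
        ∀ i, (Fin.cons z v : Fin (n + 1) → ℂ) i ≠ 0 := by
      intro z v hz hv i
      refine Fin.cases ?_ (fun j => ?_) i
      · simpa using hz
      · simpa using hv j
    -- the slice at height `t`
    let sec : C(torusCompl r k, torusCompl f g) := ⟨fun v => ⟨Fin.cons t v.1, by
      refine ⟨hcons t v.1 ht v.2.1, ?_⟩
      rcases v.2.2 with hv | hv
      · exact hr_mem t v.1 hv
      · exact hk_mem v.1 hv⟩, by
      refine Continuous.subtype_mk ?_ _
      exact Continuous.finCons continuous_const continuous_subtype_val⟩
    let i : C(torusCompl r 0, torusCompl r k) :=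
      ⟨fun v => ⟨v.1, v.2.1, Or.inl (by simpa using v.2.2)⟩, by fun_prop⟩
    let e : C({z : ℂ // z ≠ 0} × torusCompl r 0, torusCompl f g) :=
      ⟨fun v => ⟨Fin.cons v.1.1 v.2.1, hcons _ _ v.1.2 v.2.2.1,
        hr_mem _ _ (by simpa using v.2.2.2)⟩, by
        refine Continuous.subtype_mk ?_ _
        exact Continuous.finCons (by fun_prop) (by fun_prop)⟩
    have hi : IsOpenEmbedding i :=
      IsOpenEmbedding.of_comp _ (isOpen_torusCompl r k).isOpenEmbedding_subtypeVal
        (isOpen_torusCompl r 0).isOpenEmbedding_subtypeVal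
    have he : IsOpenEmbedding e := by
      refine IsOpenEmbedding.of_comp _ (isOpen_torusCompl f g).isOpenEmbedding_subtypeVal ?_
      have h1 : IsOpenEmbedding (Subtype.val : {z : ℂ // z ≠ 0} → ℂ) :=
        (isOpen_ne : IsOpen {z : ℂ | z ≠ 0}).isOpenEmbedding_subtypeVal
      exact (Fin.consEquivL ℂ (fun _ : Fin (n + 1) => ℂ)).toHomeomorph.isOpenEmbedding.comp
        (h1.prodMap (isOpen_torusCompl r 0).isOpenEmbedding_subtypeVal)
    have hiT : IsTame (range i) := by
      refine (isTame_eval_ne_zero (isOpen_torusCompl r k) hr).mono fun y hy => ?_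
      exact ⟨⟨y.1, y.2.1, Or.inl hy⟩, rfl⟩
    have heT : IsTame (range e) := by
      have hr' : MvPolynomial.rename Fin.succ r ≠ 0 := by
        exact (map_ne_zero_iff _ (MvPolynomial.rename_injective _ (Fin.succ_injective n))).2 hr
      refine (isTame_eval_ne_zero (isOpen_torusCompl f g) hr').mono fun y hy => ?_
      have hy' : MvPolynomial.eval (fun j => y.1 (Fin.succ j)) r ≠ 0 := by
        simpa [MvPolynomial.eval_rename, Function.comp_def] using hy
      refine ⟨(⟨y.1 0, y.2.1 0⟩, ⟨fun j => y.1 j.succ, fun j => y.2.1 _, Or.inl hy'⟩),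
        Subtype.ext ?_⟩
      exact Fin.cons_self_tail y.1
    have hW : PathConnectedSpace (torusCompl r 0) :=
      isPathConnected_iff_pathConnectedSpace.1 (isPathConnected_torusCompl_zero hr)
    have hA := isQuotientOfLattice_punctured
    have hA1 := hA.1
    have : PathConnectedSpace (torusCompl f g) :=
      heT.pathConnectedSpace (isPathConnected_range e.continuous)
    let w : torusCompl r 0 := Classical.arbitrary _
    exact IsQuotientOfLattice.of_slice hA (ih r k hrel) i e sec ⟨t, ht⟩ w
      (map_surjective_of_isTame i hi hiT w) (map_surjective_of_isTame e he heT _) (fun w' => rfl)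

end ClusterType

end

/-! ### The Euclidean topology on complex points. -/

noncomputable section

namespace ClusterType

open Set Topology

namespace ComplexPoints

variable {X Y : Scheme.{0}} [X.Over SpecC] [Y.Over SpecC]

theorem eq_closedPoint (s : SpecC) : s = IsLocalRing.closedPoint ℂ :=
  Subsingleton.elim (α := PrimeSpectrum ℂ) _ _

theorem top_le_preimage_iff (p : ComplexPoints X) (U : X.Opens) :
    ⊤ ≤ p.1 ⁻¹ᵁ U ↔ p.pt ∈ U := by
  refine ⟨fun h => h (x := IsLocalRing.closedPoint ℂ) trivial, fun h s _ => ?_⟩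
  rw [eq_closedPoint s]
  exact h

/-- The map on complex points induced by a morphism over `ℂ`. -/
def map (f : X ⟶ Y) [f.IsOver SpecC] (p : ComplexPoints X) : ComplexPoints Y :=
  ⟨p.1 ≫ f, by rw [Category.assoc, comp_over, p.2]⟩

variable (f : X ⟶ Y) [f.IsOver SpecC]

theorem pt_map (p : ComplexPoints X) : (map f p).pt = f p.pt := rfl

theorem eval_map (p : ComplexPoints X) (U : Y.Opens) (h : ⊤ ≤ (map f p).1 ⁻¹ᵁ U)
    (h' : ⊤ ≤ p.1 ⁻¹ᵁ (f ⁻¹ᵁ U)) (s : Γ(Y, U)) :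
    (map f p).eval U h s = p.eval (f ⁻¹ᵁ U) h' (f.app U s) := by
  simp only [eval, map]
  congr 1

theorem continuous_map : Continuous (map f) := by
  refine continuous_generateFrom_iff.2 ?_
  rintro _ ⟨U, s, W, hW, rfl⟩
  refine TopologicalSpace.isOpen_generateFrom_of_mem ⟨f ⁻¹ᵁ U, f.app U s, W, hW, ?_⟩
  ext p
  have hiff : ⊤ ≤ (map f p).1 ⁻¹ᵁ U ↔ ⊤ ≤ p.1 ⁻¹ᵁ (f ⁻¹ᵁ U) := by
    rw [top_le_preimage_iff, top_le_preimage_iff, pt_map]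
    rfl
  constructor
  · rintro ⟨h, h1⟩
    exact ⟨hiff.1 h, by rwa [← eval_map f p U h]⟩
  · rintro ⟨h, h1⟩
    exact ⟨hiff.2 h, by rwa [eval_map f p U (hiff.2 h) h]⟩

theorem isOpen_setOf_pt_mem (U : X.Opens) : IsOpen {p : ComplexPoints X | p.pt ∈ U} := by
  refine TopologicalSpace.isOpen_generateFrom_of_mem ⟨U, 0, univ, isOpen_univ, ?_⟩
  ext p
  exact ⟨fun h => ⟨(top_le_preimage_iff p U).2 h, trivial⟩, fun h => (top_le_preimage_iff p U).1 h.1⟩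

theorem range_map [IsOpenImmersion f] : range (map f) = {p | p.pt ∈ f.opensRange} := by
  ext p
  constructor
  · rintro ⟨q, rfl⟩
    simp [pt_map]
  · intro hp
    have hsub : range p.1 ⊆ range f := by
      rintro _ ⟨s, rfl⟩
      rw [eq_closedPoint s]
      exact hp
    refine ⟨⟨IsOpenImmersion.lift f p.1 hsub, ?_⟩, Subtype.ext (IsOpenImmersion.lift_fac f p.1 hsub)⟩
    rw [← comp_over f, ← Category.assoc, IsOpenImmersion.lift_fac]
    exact p.2

/-- A section over an open subset of the source is also a section over its image, with the same
values. Each generating open set of the source is thus the preimage of one of the target. -/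
theorem isOpenEmbedding_map [IsOpenImmersion f] : IsOpenEmbedding (map f) := by
  refine ⟨⟨⟨le_antisymm (continuous_map f).le_induced ?_⟩, fun p q h => ?_⟩, ?_⟩
  · refine le_generateFrom ?_
    rintro _ ⟨U, s, W, hW, rfl⟩
    refine isOpen_induced_iff.2 ⟨_, TopologicalSpace.isOpen_generateFrom_of_mem
      ⟨f ''ᵁ U, (f.appIso U).inv s, W, hW, rfl⟩, ?_⟩
    ext p
    have hiff : ⊤ ≤ (map f p).1 ⁻¹ᵁ (f ''ᵁ U) ↔ ⊤ ≤ p.1 ⁻¹ᵁ U := by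
      rw [top_le_preimage_iff, top_le_preimage_iff, pt_map, Scheme.Hom.apply_mem_image_iff]
    have hev : ∀ h h', (map f p).eval (f ''ᵁ U) h ((f.appIso U).inv s) = p.eval U h' s := by
      intro h h'
      simp only [eval, map]
      congr 1
      rw [← CommRingCat.comp_apply, ← Scheme.Hom.appLE_comp_appLE p.1 f (f ''ᵁ U) U ⊤
        (by rw [Scheme.Hom.preimage_image_eq]) h', ← Category.assoc, Scheme.Hom.appIso_inv_appLE]
      simp
    constructor
    · rintro ⟨h, h1⟩
      exact ⟨hiff.1 h, by rwa [← hev h]⟩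
    · rintro ⟨h, h1⟩
      exact ⟨hiff.2 h, by rwa [hev (hiff.2 h) h]⟩
  · have := congrArg Subtype.val h
    exact Subtype.ext ((cancel_mono f).1 this)
  · rw [range_map]
    exact isOpen_setOf_pt_mem _

/-- The value at a complex point as a ring homomorphism. -/
def evalHom (p : ComplexPoints X) (U : X.Opens) (h : ⊤ ≤ p.1 ⁻¹ᵁ U) : Γ(X, U) →+* ℂ :=
  ((p.1.appLE U ⊤ h) ≫ (Scheme.ΓSpecIso (.of ℂ)).hom).hom

theorem evalHom_apply (p : ComplexPoints X) (U : X.Opens) (h : ⊤ ≤ p.1 ⁻¹ᵁ U) (s : Γ(X, U)) :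
    p.evalHom U h s = p.eval U h s := rfl

theorem eval_presheaf_map (p : ComplexPoints X) {U V : X.Opens} (i : V ≤ U)
    (hU : ⊤ ≤ p.1 ⁻¹ᵁ U) (hV : ⊤ ≤ p.1 ⁻¹ᵁ V) (s : Γ(X, U)) :
    p.eval V hV (X.presheaf.map (homOfLE i).op s) = p.eval U hU s := by
  simp only [eval]
  congr 1
  rw [← CommRingCat.comp_apply, Scheme.Hom.map_appLE]

theorem pt_mem_basicOpen_iff (p : ComplexPoints X) {U : X.Opens} (h : ⊤ ≤ p.1 ⁻¹ᵁ U)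
    (s : Γ(X, U)) : p.pt ∈ X.basicOpen s ↔ p.eval U h s ≠ 0 := by
  have hU : p.pt ∈ U := (top_le_preimage_iff p U).1 h
  rw [← isUnit_iff_ne_zero, ← evalHom_apply]
  constructor
  · intro hs
    have hs' := (top_le_preimage_iff p _).2 hs
    rw [evalHom_apply, ← eval_presheaf_map p (X.basicOpen_le s) h hs', ← evalHom_apply]
    exact (RingedSpace.isUnit_res_basicOpen X.toRingedSpace s).map _
  · intro hs
    have h1 : IsUnit (p.1.appLE U ⊤ h s) := by
      have := hs.map (Scheme.ΓSpecIso (.of ℂ)).inv.hom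
      simpa [evalHom] using this
    have h2 : (p.1 ⁻¹ᵁ X.basicOpen s) = ⊤ := by
      have h3 : SpecC.basicOpen (p.1.appLE U ⊤ h s) = ⊤ := Scheme.basicOpen_of_isUnit _ h1
      rw [Scheme.Hom.appLE, CommRingCat.comp_apply, Scheme.basicOpen_res, ← Scheme.preimage_basicOpen,
        top_inf_eq] at h3
      exact h3
    exact (top_le_preimage_iff p _).1 h2.ge

/-- The Euclidean topology on the complex points of an affine scheme is the topology of pointwise
convergence of global functions. -/
theorem isInducing_eval_top [IsAffine X] :
    IsInducing fun (p : ComplexPoints X) (s : Γ(X, ⊤)) => p.eval ⊤ le_top s := by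
  refine ⟨le_antisymm ?_ (le_generateFrom ?_)⟩
  · rw [← continuous_iff_le_induced]
    refine continuous_pi fun s => ⟨fun W hW => ?_⟩
    refine TopologicalSpace.isOpen_generateFrom_of_mem ⟨⊤, s, W, hW, ?_⟩
    ext p
    exact ⟨fun h => ⟨le_top, h⟩, fun h => h.2⟩
  · rintro _ ⟨U, s, W, hW, rfl⟩
    let ev : ComplexPoints X → Γ(X, ⊤) → ℂ := fun p s => p.eval ⊤ le_top s
    let := TopologicalSpace.induced ev Pi.topologicalSpace
    have hc : ∀ s : Γ(X, ⊤), Continuous fun p : ComplexPoints X => p.eval ⊤ le_top s := fun s =>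
      Continuous.comp (g := fun φ : Γ(X, ⊤) → ℂ => φ s) (_root_.continuous_apply s)
        (continuous_induced_dom (f := ev))
    refine isOpen_iff_mem_nhds.2 ?_
    rintro p ⟨hU, hp⟩
    -- Near `p`, on a basic open set of `b`, the section `s` is a fraction `a / b ^ m` of global
    -- functions, so its values depend continuously on the values of `a` and `b`.
    obtain ⟨_, ⟨_, ⟨b, rfl⟩, rfl⟩, hpb, hbU'⟩ :=
      (isBasis_basicOpen X).exists_subset_of_mem_open ((top_le_preimage_iff p U).1 hU) U.2
    have hbU : X.basicOpen b ≤ U := hbU'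
    have hloc := (isAffineOpen_top X).isLocalization_basicOpen b
    obtain ⟨a, ⟨_, ⟨m, rfl⟩⟩, hab⟩ := IsLocalization.exists_mk'_eq (.powers b)
      (X.presheaf.map (homOfLE hbU).op s)
    rw [eq_comm, IsLocalization.eq_mk'_iff_mul_eq] at hab
    have hval : ∀ q : ComplexPoints X, q.eval ⊤ le_top b ≠ 0 → ∃ h, q.eval U h s =
        q.eval ⊤ le_top a / q.eval ⊤ le_top b ^ m := by
      intro q hq
      have hqb := (pt_mem_basicOpen_iff q le_top b).2 hq
      have hqb' := (top_le_preimage_iff q _).2 hqb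
      have hqU := (top_le_preimage_iff q U).2 (hbU hqb)
      refine ⟨hqU, ?_⟩
      rw [eq_div_iff (pow_ne_zero m hq)]
      have h1 := congrArg (q.evalHom (X.basicOpen b) hqb') hab
      have h2 : ∀ c : Γ(X, ⊤), q.evalHom (X.basicOpen b) hqb'
          (algebraMap Γ(X, ⊤) Γ(X, X.basicOpen b) c) = q.eval ⊤ le_top c := fun c =>
        eval_presheaf_map q (X.basicOpen_le b) le_top hqb' c
      have h3 : q.evalHom (X.basicOpen b) hqb' (X.presheaf.map (homOfLE hbU).op s) =
        q.eval U hqU s := eval_presheaf_map q hbU hqU hqb' s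
      have h4 : q.eval ⊤ le_top (b ^ m) = q.eval ⊤ le_top b ^ m :=
        map_pow (q.evalHom ⊤ le_top) b m
      rw [map_mul, h2, h2, h3] at h1
      rw [← h4]
      exact h1
    have hb0 := (pt_mem_basicOpen_iff p le_top b).1 hpb
    have hev : ∀ᶠ q in 𝓝 p, q.eval ⊤ le_top b ≠ 0 :=
      (hc b).continuousAt.eventually_ne hb0
    have hdiv : ContinuousAt (fun q : ComplexPoints X =>
        q.eval ⊤ le_top a / q.eval ⊤ le_top b ^ m) p :=
      (hc a).continuousAt.div ((hc b).pow m).continuousAt (pow_ne_zero m hb0)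
    have hmem : p.eval ⊤ le_top a / p.eval ⊤ le_top b ^ m ∈ W := by
      obtain ⟨h, hh⟩ := hval p hb0
      rwa [← hh]
    filter_upwards [hev, hdiv.eventually_mem (hW.mem_nhds hmem)] with q hq hqW
    obtain ⟨h, hh⟩ := hval q hq
    exact ⟨h, by rwa [hh]⟩

end ComplexPoints

/-! ### Affine schemes -/

section Affine

variable (A : Type) [CommRing A] [Algebra ℂ A]

/-- The spectrum of a `ℂ`-algebra as a scheme over `ℂ`. -/
@[reducible] def specOver : (Spec (.of A)).Over SpecC :=
  ⟨Spec.map (CommRingCat.ofHom (algebraMap ℂ A))⟩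

attribute [local instance] specOver

/-- The `ℂ`-valued points of a `ℂ`-algebra, with the topology of pointwise convergence. -/
def AlgPoints : Type := A →ₐ[ℂ] ℂ

instance : FunLike (AlgPoints A) A ℂ := inferInstanceAs (FunLike (A →ₐ[ℂ] ℂ) A ℂ)

instance : AlgHomClass (AlgPoints A) ℂ A ℂ := inferInstanceAs (AlgHomClass (A →ₐ[ℂ] ℂ) ℂ A ℂ)

instance : TopologicalSpace (AlgPoints A) :=
  TopologicalSpace.induced (fun χ (a : A) => χ a) inferInstance

variable {A}

theorem AlgPoints.continuous_apply (a : A) : Continuous fun χ : AlgPoints A => χ a :=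
  (_root_.continuous_apply a).comp continuous_induced_dom

/-- The complex point of `Spec A` defined by an algebra homomorphism. -/
def AlgPoints.toComplexPoint (χ : AlgPoints A) : ComplexPoints (Spec (.of A)) :=
  ⟨Spec.map (CommRingCat.ofHom (χ : A →ₐ[ℂ] ℂ).toRingHom), by
    change _ ≫ Spec.map _ = _
    rw [← Spec.map_comp, ← CommRingCat.ofHom_comp, ← Spec.map_id]
    congr 1
    ext z
    exact (χ : A →ₐ[ℂ] ℂ).commutes z⟩

theorem AlgPoints.toComplexPoint_bijective :
    Function.Bijective (AlgPoints.toComplexPoint (A := A)) := by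
  constructor
  · intro χ ψ h
    have h1 := Spec.map_injective (congrArg Subtype.val h)
    refine DFunLike.ext _ _ fun a => ?_
    exact congrArg (fun f => f.hom a) h1
  · rintro ⟨p, hp⟩
    obtain ⟨φ, rfl⟩ := Spec.map_surjective p
    have h1 : CommRingCat.ofHom (algebraMap ℂ A) ≫ φ = 𝟙 _ := by
      apply Spec.map_injective
      rw [Spec.map_comp, Spec.map_id]
      exact hp
    exact ⟨⟨φ.hom, fun z => congrArg (fun f => f.hom z) h1⟩, rfl⟩

theorem AlgPoints.eval_toComplexPoint (χ : AlgPoints A) (s : Γ(Spec (.of A), ⊤)) :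
    χ.toComplexPoint.eval ⊤ le_top s = χ ((Scheme.ΓSpecIso (.of A)).hom s) := by
  have h := Scheme.ΓSpecIso_naturality (CommRingCat.ofHom (χ : A →ₐ[ℂ] ℂ).toRingHom)
  have h1 := congrArg (fun f => f.hom s) h
  refine Eq.trans (congrArg (fun φ : Γ(Spec (.of A), ⊤) ⟶ Γ(SpecC, ⊤) =>
    (Scheme.ΓSpecIso (.of ℂ)).hom (φ.hom s)) ?_) h1
  exact (Scheme.Hom.app_eq_appLE _).symm

/-- Both topologies are pointwise convergence, on the elements of `A` and on the global functions of
its spectrum. -/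
theorem AlgPoints.isHomeomorph_toComplexPoint :
    IsHomeomorph (AlgPoints.toComplexPoint (A := A)) := by
  have hind : IsInducing (AlgPoints.toComplexPoint (A := A)) := by
    rw [ComplexPoints.isInducing_eval_top.of_comp_iff.symm]
    let e : Γ(Spec (.of A), ⊤) ≃ A :=
      ((Scheme.ΓSpecIso (.of A)).commRingCatIsoToRingEquiv).toEquiv
    have h1 : IsInducing fun (χ : AlgPoints A) (a : A) => χ a := ⟨rfl⟩
    have h2 := (Homeomorph.piCongrLeft (Y := fun _ : A => ℂ) e).symm.isInducing.comp h1
    convert h2 using 1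
    ext χ s
    exact AlgPoints.eval_toComplexPoint χ s
  exact (isHomeomorph_iff_isEmbedding_surjective).2
    ⟨⟨hind, toComplexPoint_bijective.1⟩, toComplexPoint_bijective.2⟩

end Affine

end ClusterType

end

/-! ### Local coordinates from submersive presentations. -/

noncomputable section

namespace ClusterType

open Set Topology

section Chart

theorem hasStrictFDerivAt_eval {ι : Type*} [Fintype ι] (p : MvPolynomial ι ℂ) (x : ι → ℂ) :
    HasStrictFDerivAt (fun y : ι → ℂ => MvPolynomial.eval y p)
      (∑ i, MvPolynomial.eval x (MvPolynomial.pderiv i p) •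
        (ContinuousLinearMap.proj i : (ι → ℂ) →L[ℂ] ℂ)) x := by
  classical
  induction p using MvPolynomial.induction_on with
  | C a =>
    simp only [MvPolynomial.eval_C]
    exact (hasStrictFDerivAt_const (𝕜 := ℂ) a x).congr_fderiv (by ext v; simp)
  | add p q hp hq =>
    simp only [map_add]
    refine (hp.fun_add hq).congr_fderiv ?_
    ext v
    simp [add_mul, Finset.sum_add_distrib]
  | mul_X p j hp =>
    have hX : HasStrictFDerivAt (fun y : ι → ℂ => y j)
      (ContinuousLinearMap.proj j : (ι → ℂ) →L[ℂ] ℂ) x :=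
      (ContinuousLinearMap.proj j : (ι → ℂ) →L[ℂ] ℂ).hasStrictFDerivAt
    simp only [map_mul, MvPolynomial.eval_X]
    refine (hp.fun_mul hX).congr_fderiv ?_
    ext v
    simp only [Derivation.leibniz, MvPolynomial.pderiv_X, smul_eq_mul, map_add, map_mul,
      MvPolynomial.eval_X, Pi.single_apply, apply_ite (MvPolynomial.eval x), map_one, map_zero]
    simp [add_mul, Finset.sum_add_distrib, Finset.mul_sum, mul_assoc]

variable {A : Type} [CommRing A] [Algebra ℂ A] {ι σ : Type}

/-- The coordinates of a point of an algebra with respect to a family of generators. -/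
def AlgPoints.coords (P : Algebra.Generators ℂ A ι) (χ : AlgPoints A) : ι → ℂ := fun i => χ (P.val i)

theorem AlgPoints.apply_aeval (P : Algebra.Generators ℂ A ι) (χ : AlgPoints A)
    (p : MvPolynomial ι ℂ) : χ (MvPolynomial.aeval P.val p) = MvPolynomial.eval (χ.coords P) p := by
  have h : (χ : A →ₐ[ℂ] ℂ).comp (MvPolynomial.aeval P.val) = MvPolynomial.aeval (χ.coords P) := by
    ext i
    change χ (MvPolynomial.aeval P.val (MvPolynomial.X i)) = _
    rw [MvPolynomial.aeval_X, MvPolynomial.aeval_X]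
    rfl
  exact congrArg (fun φ => φ p) h

theorem AlgPoints.apply_eq_eval (P : Algebra.Generators ℂ A ι) (χ : AlgPoints A) (a : A) :
    χ a = MvPolynomial.eval (χ.coords P) (P.σ a) := by
  rw [← AlgPoints.apply_aeval, P.aeval_val_σ]

theorem AlgPoints.coords_injective (P : Algebra.Generators ℂ A ι) :
    Function.Injective (AlgPoints.coords P) := fun χ ψ h =>
  DFunLike.ext _ _ fun a => by rw [χ.apply_eq_eval P, ψ.apply_eq_eval P, h]

/-- Every value `χ a` is a polynomial in the values on the generators. -/
theorem AlgPoints.isInducing_coords (P : Algebra.Generators ℂ A ι) :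
    IsInducing (AlgPoints.coords P) := by
  refine ⟨le_antisymm ?_ ?_⟩
  · rw [← continuous_iff_le_induced]
    exact continuous_pi fun i => AlgPoints.continuous_apply _
  · let := TopologicalSpace.induced (AlgPoints.coords P) Pi.topologicalSpace
    change _ ≤ TopologicalSpace.induced _ _
    rw [← continuous_iff_le_induced]
    refine continuous_pi fun a => ?_
    have h1 : Continuous (AlgPoints.coords P) := continuous_induced_dom
    simp only [AlgPoints.apply_eq_eval P]
    exact (MvPolynomial.continuous_eval _).comp h1

/-- The relations span the kernel of the presentation, so evaluation at a common zero descends to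
`A`. -/
theorem AlgPoints.exists_coords_eq (P : Algebra.Presentation ℂ A ι σ) {x : ι → ℂ}
    (hx : ∀ s, MvPolynomial.eval x (P.relation s) = 0) :
    ∃ χ : AlgPoints A, χ.coords P.toGenerators = x := by
  have hker : ∀ a ∈ P.ker, MvPolynomial.aeval x a = 0 := by
    intro a ha
    rw [← P.span_range_relation_eq_ker] at ha
    have hle : Ideal.span (range P.relation) ≤ RingHom.ker (MvPolynomial.aeval (R := ℂ) x) := by
      rw [Ideal.span_le]
      rintro _ ⟨s, rfl⟩
      simpa using hx s
    exact hle ha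
  let φ : P.Ring ⧸ P.ker →ₐ[ℂ] ℂ := Ideal.Quotient.liftₐ P.ker (MvPolynomial.aeval x) hker
  let e : (P.Ring ⧸ P.ker) ≃ₐ[ℂ] A := P.quotientEquiv.restrictScalars ℂ
  refine ⟨φ.comp e.symm.toAlgHom, ?_⟩
  ext i
  have h1 : e.symm (P.val i) = Ideal.Quotient.mk P.ker (MvPolynomial.X i) := by
    rw [AlgEquiv.symm_apply_eq]
    change _ = algebraMap P.Ring A (MvPolynomial.X i)
    simp [P.algebraMap_apply]
  change φ (e.symm (P.val i)) = x i
  rw [h1]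
  change MvPolynomial.aeval x (MvPolynomial.X i : MvPolynomial ι ℂ) = x i
  simp

/-- The free variables of a submersive presentation. -/
abbrev freeVars (P : Algebra.PreSubmersivePresentation ℂ A ι σ) : Type := {i : ι // i ∉ range P.map}

/-- The free variables of a submersive presentation are local coordinates. -/
theorem exists_chart [Finite ι] [Finite σ] (P : Algebra.SubmersivePresentation ℂ A ι σ)
    (χ₀ : AlgPoints A) : ∃ e : OpenPartialHomeomorph (AlgPoints A)
      (freeVars P.toPreSubmersivePresentation → ℂ), χ₀ ∈ e.source ∧
        ∀ χ, e χ = fun k => χ (P.val k.1) := by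
  classical
  have := Fintype.ofFinite ι
  have := Fintype.ofFinite σ
  let G := P.toGenerators
  set x₀ := χ₀.coords G
  -- The points of `A` are the zero locus of the first component of `Φ`. Once `Φ` is inverted
  -- locally, the slice over `0` is the desired chart.
  let Φ : (ι → ℂ) → (σ → ℂ) × (freeVars P.toPreSubmersivePresentation → ℂ) :=
    fun x => (fun s => MvPolynomial.eval x (P.relation s), fun k => x k.1)
  let L₁ : (ι → ℂ) →L[ℂ] (σ → ℂ) := ContinuousLinearMap.pi fun s =>
    ∑ i, MvPolynomial.eval x₀ (MvPolynomial.pderiv i (P.relation s)) • ContinuousLinearMap.proj i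
  let L₂ : (ι → ℂ) →L[ℂ] (freeVars P.toPreSubmersivePresentation → ℂ) :=
    ContinuousLinearMap.pi fun k => ContinuousLinearMap.proj k.1
  let L := L₁.prod L₂
  have hΦ : HasStrictFDerivAt Φ L x₀ := by
    refine HasStrictFDerivAt.prodMk (hasStrictFDerivAt_pi.2 fun s => hasStrictFDerivAt_eval _ _) ?_
    exact L₂.hasStrictFDerivAt
  have hdet : (P.jacobiMatrix.map (MvPolynomial.eval x₀)).det ≠ 0 := by
    have h1 := P.jacobian_isUnit
    rw [P.jacobian_eq_jacobiMatrix_det] at h1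
    have h2 := h1.map χ₀
    rw [P.algebraMap_apply, AlgPoints.apply_aeval, ← RingHom.coe_coe] at h2
    have h3 := (MvPolynomial.eval x₀).map_det P.jacobiMatrix
    rw [RingHom.mapMatrix_apply] at h3
    rw [← h3]
    exact h2.ne_zero
  -- A kernel vector has no free components, and the invertible Jacobian matrix kills the remaining
  -- ones.
  have hinj : Function.Injective L := by
    rw [injective_iff_map_eq_zero]
    intro v hv
    have hv2 : ∀ i, i ∉ range P.map → v i = 0 := fun i hi =>
      congrFun (congrArg Prod.snd hv) (⟨i, hi⟩ : freeVars P.toPreSubmersivePresentation)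
    have hv1 : ∀ s, ∑ i, MvPolynomial.eval x₀ (MvPolynomial.pderiv i (P.relation s)) * v i = 0 := by
      intro s
      have := congrFun (congrArg Prod.fst hv) s
      simpa [L, L₁] using this
    have hvm : (fun s => v (P.map s)) = 0 := by
      refine Matrix.eq_zero_of_vecMul_eq_zero hdet ?_
      ext s
      rw [Matrix.vecMul, dotProduct, Pi.zero_apply, ← hv1 s]
      refine Finset.sum_of_injOn P.map P.map_inj.injOn (by simp) ?_ ?_
      · intro i _ hi
        rw [hv2 i (by simpa using hi), mul_zero]
      · intro s' _
        rw [Matrix.map_apply, P.jacobiMatrix_apply, mul_comm]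
    ext i
    by_cases hi : i ∈ range P.map
    · obtain ⟨s, rfl⟩ := hi
      exact congrFun hvm s
    · exact hv2 i hi
  have hfin : Module.finrank ℂ (ι → ℂ) =
      Module.finrank ℂ ((σ → ℂ) × (freeVars P.toPreSubmersivePresentation → ℂ)) := by
    rw [Module.finrank_prod, Module.finrank_fintype_fun_eq_card, Module.finrank_fintype_fun_eq_card,
      Module.finrank_fintype_fun_eq_card, ← Set.card_range_of_injective P.map_inj]
    exact (Fintype.card_congr (Equiv.Set.sumCompl (range P.map)).symm).trans Fintype.card_sum
  let E : (ι → ℂ) ≃L[ℂ] (σ → ℂ) × (freeVars P.toPreSubmersivePresentation → ℂ) :=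
    (LinearEquiv.ofInjectiveOfFinrankEq L.toLinearMap hinj hfin).toContinuousLinearEquiv
  have hE : (E : (ι → ℂ) →L[ℂ] _) = L := by
    ext v <;> rfl
  have hΦ' : HasStrictFDerivAt Φ (E : (ι → ℂ) →L[ℂ] _) x₀ := hE ▸ hΦ
  let Ψ := hΦ'.toOpenPartialHomeomorph Φ
  have hΨ : ∀ x, Ψ x = Φ x := fun x => rfl
  have hrel : ∀ χ : AlgPoints A, Φ (χ.coords G) = (0, fun k => χ (P.val k.1)) := by
    intro χ
    refine Prod.ext (funext fun s => ?_) rfl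
    change MvPolynomial.eval (χ.coords G) (P.relation s) = 0
    rw [← AlgPoints.apply_aeval, show MvPolynomial.aeval G.val (P.relation s) = 0 from
      P.aeval_val_relation s, map_zero]
  -- Off the zero locus the value is the default `χ₀`; the inverse chart only meets points where the
  -- relations vanish.
  have hex : ∀ x : ι → ℂ, ∃ χ : AlgPoints A, (Φ x).1 = 0 → χ.coords G = x := by
    intro x
    by_cases hx : (Φ x).1 = 0
    · obtain ⟨χ, hχ⟩ := AlgPoints.exists_coords_eq P.toPresentation (x := x) (fun s => congrFun hx s)
      exact ⟨χ, fun _ => hχ⟩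
    · exact ⟨χ₀, fun h => absurd h hx⟩
  choose pt hpt using hex
  have hptsymm : ∀ w, ((0 : σ → ℂ), w) ∈ Ψ.target →
      (pt (Ψ.symm (0, w))).coords G = Ψ.symm (0, w) := by
    intro w hw
    refine hpt _ ?_
    rw [← hΨ, Ψ.right_inv hw]
  have hcoords : Continuous (AlgPoints.coords G) := (AlgPoints.isInducing_coords G).continuous
  refine ⟨{
    toFun := fun χ k => χ (P.val k.1)
    invFun := fun w => pt (Ψ.symm (0, w))
    source := AlgPoints.coords G ⁻¹' Ψ.source
    target := (fun w => ((0 : σ → ℂ), w)) ⁻¹' Ψ.target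
    map_source' := fun χ hχ => ?_
    map_target' := fun w hw => ?_
    left_inv' := fun χ hχ => ?_
    right_inv' := fun w hw => ?_
    open_source := Ψ.open_source.preimage hcoords
    open_target := Ψ.open_target.preimage (by fun_prop)
    continuousOn_toFun := ?_
    continuousOn_invFun := ?_ }, ?_, fun χ => rfl⟩
  · have := Ψ.map_source hχ
    rwa [hΨ, hrel] at this
  · rw [mem_preimage, hptsymm w hw]
    exact Ψ.map_target hw
  · have h1 := Ψ.left_inv hχ
    rw [hΨ, hrel] at h1
    have h2 : ((0 : σ → ℂ), fun k : freeVars P.toPreSubmersivePresentation => χ (P.val k.1)) ∈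
        Ψ.target := by
      have := Ψ.map_source hχ
      rwa [hΨ, hrel] at this
    refine AlgPoints.coords_injective G ?_
    rw [hptsymm _ h2, h1]
  · have h1 := Ψ.right_inv hw
    rw [hΨ, ← hptsymm w hw, hrel] at h1
    exact congrArg Prod.snd h1
  · exact (continuous_pi fun k => AlgPoints.continuous_apply _).continuousOn
  · rw [(AlgPoints.isInducing_coords G).continuousOn_iff]
    have h1 : ContinuousOn (fun w => Ψ.symm ((0 : σ → ℂ), w))
        ((fun w => ((0 : σ → ℂ), w)) ⁻¹' Ψ.target) :=
      Ψ.continuousOn_symm.comp (by fun_prop) (mapsTo_preimage _ _)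
    exact h1.congr fun w hw => hptsymm w hw
  · exact hΦ'.mem_toOpenPartialHomeomorph_source

/-- A nonzero element of a standard smooth domain divides a nonzero polynomial in the free
variables, or there is an algebraic relation between the latter. -/
theorem isAlgebraic_of_formallyUnramified {R A : Type*} [CommRing R] [IsDomain R] [CommRing A]
    [IsDomain A] [Algebra R A] [FaithfulSMul R A] [Algebra.FiniteType R A]
    [Algebra.FormallyUnramified R A] (g : A) : IsAlgebraic R g := by
  -- Over fraction fields, formally unramified and essentially of finite type means separable, in
  -- particular algebraic; algebraicity then descends to `R` and `A`.
  let K := FractionRing R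
  let L := FractionRing A
  have : FaithfulSMul R L := .trans R A L
  let : Algebra K L := FractionRing.liftAlgebra R L
  have : IsScalarTower R K L := FractionRing.isScalarTower_liftAlgebra R L
  have : Algebra.FormallyUnramified A L := .of_isLocalization (nonZeroDivisors A)
  have : Algebra.FormallyUnramified R L := .comp R A L
  have : Algebra.FormallyUnramified K L := .of_restrictScalars R K L
  have : Algebra.EssFiniteType A L := .of_isLocalization L (nonZeroDivisors A)
  have : Algebra.EssFiniteType R L := .comp R A L
  have : Algebra.EssFiniteType K L := .of_comp R K L
  have : Algebra.IsSeparable K L := Algebra.FormallyUnramified.isSeparable K L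
  have h1 : IsAlgebraic K (algebraMap A L g) := Algebra.IsAlgebraic.isAlgebraic _
  have h2 : IsAlgebraic R (algebraMap A L g) := (IsFractionRing.isAlgebraic_iff R K L).2 h1
  exact (isAlgebraic_algebraMap_iff (IsFractionRing.injective A L)).1 h2

/-- The surjection from the differentials over `k` to those over `R` kills the basis, which consists
of differentials of elements of `R`. -/
theorem formallyUnramified_of_basis {k R A κ : Type*} [CommRing k] [CommRing R] [CommRing A]
    [Algebra k R] [Algebra k A] [Algebra R A] [IsScalarTower k R A]
    (b : Module.Basis κ A (KaehlerDifferential k A)) (r : κ → R)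
    (h : ∀ i, b i = KaehlerDifferential.D k A (algebraMap R A (r i))) :
    Algebra.FormallyUnramified R A := by
  constructor
  have hs := KaehlerDifferential.map_surjective k R A
  have hzero : KaehlerDifferential.map k R A A = 0 := by
    refine b.ext fun i => ?_
    rw [h, KaehlerDifferential.map_D, LinearMap.zero_apply, Algebra.algebraMap_self,
      RingHom.id_apply, Derivation.map_algebraMap]
  refine ⟨fun x y => ?_⟩
  obtain ⟨x, rfl⟩ := hs x
  obtain ⟨y, rfl⟩ := hs y
  rw [hzero]
  rfl

/-- If the free variables satisfy an algebraic relation, that relation vanishes at every point.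
Otherwise their differentials form a basis, `A` is formally unramified over the polynomial ring, and
`g` is algebraic over it; in a domain it then divides a nonzero polynomial in the free variables. -/
theorem exists_polynomial_vanishing [IsDomain A] [Finite ι] [Finite σ]
    (P : Algebra.SubmersivePresentation ℂ A ι σ) {g : A} (hg : g ≠ 0) :
    ∃ p : MvPolynomial (freeVars P.toPreSubmersivePresentation) ℂ, p ≠ 0 ∧
      ∀ χ : AlgPoints A, χ g = 0 → MvPolynomial.eval (fun k => χ (P.val k.1)) p = 0 := by
  let φ : MvPolynomial (freeVars P.toPreSubmersivePresentation) ℂ →ₐ[ℂ] A :=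
    MvPolynomial.aeval fun k => P.val k.1
  have hφ : ∀ (χ : AlgPoints A) (p),
      χ (φ p) = MvPolynomial.eval (fun k => χ (P.val k.1)) p := by
    intro χ p
    have h : (χ : A →ₐ[ℂ] ℂ).comp φ = MvPolynomial.aeval (fun k => χ (P.val k.1)) := by
      ext k
      rw [MvPolynomial.aeval_X]
      exact congrArg χ (MvPolynomial.aeval_X
        (fun k : freeVars P.toPreSubmersivePresentation => P.val k.1) k)
    exact congrArg (fun ψ => ψ p) h
  by_cases hinj : Function.Injective φ
  swap
  · rw [injective_iff_map_eq_zero] at hinj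
    push Not at hinj
    obtain ⟨p, hp, hp0⟩ := hinj
    exact ⟨p, hp0, fun χ _ => by rw [← hφ, hp, map_zero]⟩
  let : Algebra (MvPolynomial (freeVars P.toPreSubmersivePresentation) ℂ) A := φ.toAlgebra
  have : IsScalarTower ℂ (MvPolynomial (freeVars P.toPreSubmersivePresentation) ℂ) A :=
    .of_algebraMap_eq fun z => (φ.commutes z).symm
  have : Algebra.FormallyUnramified (MvPolynomial (freeVars P.toPreSubmersivePresentation) ℂ) A := by
    refine formallyUnramified_of_basis (k := ℂ) P.basisKaehler
      (fun k => MvPolynomial.X ⟨k.1, k.2⟩) fun k => ?_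
    rw [Algebra.SubmersivePresentation.basisKaehler_apply]
    exact congrArg _ (MvPolynomial.aeval_X
      (fun k : freeVars P.toPreSubmersivePresentation => P.val k.1) _).symm
  have : Algebra.FiniteType ℂ A := P.toGenerators.finiteType
  have : Algebra.FiniteType (MvPolynomial (freeVars P.toPreSubmersivePresentation) ℂ) A :=
    .of_restrictScalars_finiteType ℂ _ A
  have hfaith : FaithfulSMul (MvPolynomial (freeVars P.toPreSubmersivePresentation) ℂ) A :=
    (faithfulSMul_iff_algebraMap_injective _ A).2 hinj
  obtain ⟨p, hp, a, ha⟩ := (isAlgebraic_of_formallyUnramified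
    (R := MvPolynomial (freeVars P.toPreSubmersivePresentation) ℂ) g).exists_nonzero_dvd
    (mem_nonZeroDivisors_of_ne_zero hg)
  refine ⟨p, hp, fun χ hχ => ?_⟩
  rw [← hφ, show φ p = g * a from ha, map_mul, hχ, zero_mul]

end Chart

end ClusterType

end

/-! ### Charts at smooth points and tameness of Zariski open subsets. -/

noncomputable section

namespace ClusterType

open Set Topology

section SmoothCharts

attribute [local instance] specOver

theorem opens_eq_top_of_nonempty {U : SpecC.Opens} {s : SpecC} (h : s ∈ U) : U = ⊤ := by
  refine top_le_iff.1 fun t _ => ?_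
  rw [ComplexPoints.eq_closedPoint t, ← ComplexPoints.eq_closedPoint s]
  exact h

/-- Around a smooth point, a scheme over `ℂ` is the spectrum of a standard smooth algebra. -/
theorem exists_submersivePresentation {X : Scheme.{0}} (f : X ⟶ SpecC)
    [LocallyOfFinitePresentation f] {x : X} (hx : x ∈ f.smoothLocus) :
    ∃ (A : Type) (_ : CommRing A) (_ : Algebra ℂ A) (ι τ : Type) (_ : Finite ι) (_ : Finite τ)
      (_ : Algebra.SubmersivePresentation ℂ A ι τ) (g : Spec (.of A) ⟶ X),
      IsOpenImmersion g ∧ g ≫ f = Spec.map (CommRingCat.ofHom (algebraMap ℂ A)) ∧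
      x ∈ range g := by
  let W := f.smoothLocus
  have hsm : Smooth (W.ι ≫ f) := by
    rw [← Scheme.Hom.smoothLocus_eq_top_iff, ← Scheme.Hom.preimage_smoothLocus_eq]
    exact top_le_iff.1 fun w _ => w.2
  obtain ⟨U, hU, V, hV, hxV, e, hst⟩ :=
    Smooth.exists_isStandardSmooth (W.ι ≫ f) (⟨x, hx⟩ : W)
  obtain rfl : U = ⊤ := opens_eq_top_of_nonempty (e hxV)
  let φ : CommRingCat.of ℂ ⟶ Γ(W, V) :=
    (Scheme.ΓSpecIso (.of ℂ)).inv ≫ (W.ι ≫ f).appLE ⊤ V e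
  let : Algebra ℂ Γ(W, V) := φ.hom.toAlgebra
  have hφ : φ.hom.IsStandardSmooth :=
    RingHom.isStandardSmooth_respectsIso.2 _
      (Scheme.ΓSpecIso (.of ℂ)).symm.commRingCatIsoToRingEquiv hst
  have hA : Algebra.IsStandardSmooth ℂ Γ(W, V) := hφ
  obtain ⟨ι, τ, hτ, hι, ⟨P⟩⟩ := hA.out
  refine ⟨Γ(W, V), inferInstance, inferInstance, ι, τ, hι, hτ, P, hV.fromSpec ≫ W.ι,
    inferInstance, ?_, ?_⟩
  · rw [Category.assoc, ← hU.SpecMap_appLE_fromSpec (W.ι ≫ f) hV e, IsAffineOpen.fromSpec_top,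
      Scheme.isoSpec_Spec_inv, ← Spec.map_comp]
    rfl
  · have h1 : (⟨x, hx⟩ : W) ∈ hV.fromSpec.opensRange := by
      rwa [IsAffineOpen.opensRange_fromSpec]
    obtain ⟨z, hz⟩ := h1
    exact ⟨z, by rw [Scheme.Hom.comp_apply, hz]; rfl⟩

/-- In the complex points of a smooth part of an integral scheme, the points of a nonempty Zariski
open subset form a tame subset. -/
theorem isTame_setOf_pt_mem (X : Scheme.{0}) [X.Over SpecC] [IsIntegral X]
    [LocallyOfFiniteType (X ↘ SpecC)] {Q : ComplexPoints X → Prop}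
    (hQ : IsOpen {p | Q p}) (hsm : ∀ p, Q p → p.pt ∈ (X ↘ SpecC).smoothLocus)
    (U : X.Opens) [Nonempty U] : IsTame {y : {p // Q p} | y.1.pt ∈ U} := by
  refine isTame_of_charts fun y => ?_
  obtain ⟨A, _, _, ι, τ, _, _, P, g, hg, hgo, x, hx⟩ :=
    exists_submersivePresentation (X ↘ SpecC) (hsm y.1 y.2)
  have : g.IsOver SpecC := ⟨hgo⟩
  have : Nonempty (Spec (.of A)) := ⟨x⟩
  have : IsIntegral (Spec (.of A)) := isIntegral_of_isOpenImmersion g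
  have : IsDomain A :=
    (Scheme.ΓSpecIso (.of A)).commRingCatIsoToRingEquiv.symm.toMulEquiv.isDomain _
  let h : AlgPoints A → ComplexPoints X := ComplexPoints.map g ∘ AlgPoints.toComplexPoint
  have hh : IsOpenEmbedding h := (ComplexPoints.isOpenEmbedding_map g).comp
    (AlgPoints.isHomeomorph_toComplexPoint).isOpenEmbedding
  obtain ⟨χ₀, hχ₀⟩ : y.1 ∈ range h := by
    have h1 : y.1 ∈ range (ComplexPoints.map g) := by
      rw [ComplexPoints.range_map]
      exact ⟨x, hx⟩
    obtain ⟨q, hq⟩ := h1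
    obtain ⟨χ, rfl⟩ := AlgPoints.toComplexPoint_bijective.2 q
    exact ⟨χ, hq⟩
  obtain ⟨e, he, hev⟩ := exists_chart P χ₀
  -- By irreducibility `U` meets the chart, so it contains the nonvanishing locus of some nonzero
  -- `b` there, and `b` can vanish only where the polynomial `p` in the coordinates does.
  obtain ⟨z, hzU, ⟨w, hw⟩⟩ : ((U : Set X) ∩ g.opensRange).Nonempty :=
    nonempty_preirreducible_inter U.2 g.opensRange.2
      (Set.nonempty_coe_sort.1 (inferInstanceAs (Nonempty U))) ⟨_, x, rfl⟩
  obtain ⟨_, ⟨b, rfl⟩, hwb, hbU⟩ := PrimeSpectrum.isTopologicalBasis_basic_opens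
    |>.exists_subset_of_mem_open (show w ∈ g ⁻¹ᵁ U by rwa [Scheme.Hom.mem_preimage, hw])
      (g ⁻¹ᵁ U).2
  have hb0 : b ≠ 0 := by
    rintro rfl
    exact hwb (Ideal.zero_mem _)
  obtain ⟨p, hp0, hp⟩ := exists_polynomial_vanishing P hb0
  have : Nonempty (AlgPoints A) := ⟨χ₀⟩
  have : Nonempty {p // Q p} := ⟨y⟩
  have hi : IsOpenEmbedding (Subtype.val : {p // Q p} → ComplexPoints X) :=
    hQ.isOpenEmbedding_subtypeVal
  have hleft : ∀ χ, (hh.toOpenPartialHomeomorph h).symm (h χ) = χ := fun χ =>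
    (hh.toOpenPartialHomeomorph h).left_inv trivial
  refine ⟨_, inferInstance, (hi.toOpenPartialHomeomorph _).trans
    ((hh.toOpenPartialHomeomorph h).symm.trans e), p, ?_, hp0, ?_⟩
  · refine ⟨trivial, ⟨χ₀, trivial, hχ₀⟩, ?_⟩
    change (hh.toOpenPartialHomeomorph h).symm y.1 ∈ e.source
    rwa [← hχ₀, hleft]
  · rintro q ⟨-, ⟨χ, -, hχ⟩, -⟩ hq
    change h χ = q.1 at hχ
    have hq' : e χ = e ((hh.toOpenPartialHomeomorph h).symm q.1) := by rw [← hχ, hleft]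
    change MvPolynomial.eval (e ((hh.toOpenPartialHomeomorph h).symm q.1)) p ≠ 0 at hq
    rw [← hq', hev] at hq
    have hχb : χ b ≠ 0 := fun h0 => hq (hp χ h0)
    have hmem : χ.toComplexPoint.pt ∈ PrimeSpectrum.basicOpen b := by
      change χ b ∉ IsLocalRing.maximalIdeal ℂ
      rw [IsLocalRing.mem_maximalIdeal, mem_nonunits_iff, not_not]
      exact hχb.isUnit
    change q.1.pt ∈ U
    rw [← hχ]
    exact hbU hmem

end SmoothCharts

end ClusterType

end

/-! ### Laurent polynomials and the complex points of the torus. -/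

noncomputable section

namespace ClusterType

open Set Topology

section Torus

attribute [local instance] specOver

/-- The ring of Laurent polynomials. -/
abbrev Laurent (n : ℕ) : Type := AddMonoidAlgebra ℂ (Fin n → ℤ)

variable {n : ℕ}

/-- The inclusion of the polynomials into the Laurent polynomials. -/
def toLaurent : MvPolynomial (Fin n) ℂ →ₐ[ℂ] Laurent n :=
  MvPolynomial.aeval fun i => AddMonoidAlgebra.single (Pi.single i 1) 1

theorem toLaurent_prod_X_pow (k : Fin n → ℕ) :
    toLaurent (∏ i, MvPolynomial.X i ^ k i) =
      AddMonoidAlgebra.single (fun i => (k i : ℤ)) (1 : ℂ) := by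
  have h : ∀ i : Fin n, toLaurent (MvPolynomial.X i ^ k i) =
      AddMonoidAlgebra.of ℂ (Fin n → ℤ) (Multiplicative.ofAdd (k i • Pi.single i 1)) := by
    intro i
    rw [map_pow, toLaurent, MvPolynomial.aeval_X, AddMonoidAlgebra.single_pow, one_pow]
    rfl
  rw [map_prod, Finset.prod_congr rfl fun i _ => h i, ← map_prod, ← ofAdd_sum]
  change AddMonoidAlgebra.single (∑ i, k i • Pi.single i 1) 1 = _
  congr 1
  ext j
  simp [Finset.sum_apply, Pi.single_apply]

/-- The Laurent point with given nonzero coordinates. -/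
def laurentPoint (x : Fin n → ℂ) (hx : ∀ i, x i ≠ 0) : AlgPoints (Laurent n) :=
  AddMonoidAlgebra.lift ℂ ℂ (Fin n → ℤ)
    { toFun := fun m => ∏ i, x i ^ (Multiplicative.toAdd m i)
      map_one' := by simp
      map_mul' := fun a b => by
        rw [← Finset.prod_mul_distrib]
        exact Finset.prod_congr rfl fun i _ => zpow_add₀ (hx i) _ _ }

theorem laurentPoint_single (x : Fin n → ℂ) (hx : ∀ i, x i ≠ 0) (m : Fin n → ℤ) (r : ℂ) :
    laurentPoint x hx (AddMonoidAlgebra.single m r) = r * ∏ i, x i ^ m i :=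
  AddMonoidAlgebra.lift_single _ _ _

theorem laurentPoint_toLaurent (x : Fin n → ℂ) (hx : ∀ i, x i ≠ 0) (p : MvPolynomial (Fin n) ℂ) :
    laurentPoint x hx (toLaurent p) = MvPolynomial.eval x p := by
  have h : (laurentPoint x hx : Laurent n →ₐ[ℂ] ℂ).comp toLaurent = MvPolynomial.aeval x := by
    ext k
    rw [MvPolynomial.aeval_X]
    refine (congrArg (laurentPoint x hx) (MvPolynomial.aeval_X
      (fun i => (AddMonoidAlgebra.single (Pi.single i 1) 1 : Laurent n)) k)).trans ?_
    rw [laurentPoint_single, one_mul, Finset.prod_eq_single k]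
    · simp
    · intro b _ hb
      rw [Pi.single_eq_of_ne hb, zpow_zero]
    · simp
  exact congrArg (fun ψ => ψ p) h

theorem isOpen_forall_ne_zero : IsOpen {x : Fin n → ℂ | ∀ i, x i ≠ 0} := by
  simp only [Set.ofPred_forall]
  exact isOpen_iInter_of_finite fun i => isOpen_ne.preimage (continuous_apply i)

/-- A nonzero polynomial is nonzero at some point with nonzero coordinates, and such a point extends
to the Laurent polynomials. -/
theorem toLaurent_injective : Function.Injective (toLaurent (n := n)) := by
  rw [injective_iff_map_eq_zero]
  intro p hp
  by_contra h0
  obtain ⟨x, hx, hxp⟩ := exists_eval_ne_zero_of_isOpen h0 isOpen_forall_ne_zero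
    ⟨fun _ => 1, fun _ => one_ne_zero⟩
  rw [← laurentPoint_toLaurent x hx, hp, map_zero] at hxp
  exact hxp rfl

theorem exists_natCast_eq_add (m : Fin n → ℤ) : ∃ (N : ℕ) (k : Fin n → ℕ),
    (∀ i, (k i : ℤ) = m i + N) := by
  refine ⟨∑ i, (m i).natAbs, fun i => (m i + (∑ i, (m i).natAbs : ℕ)).toNat, fun i => ?_⟩
  refine Int.toNat_of_nonneg ?_
  have h1 : (m i).natAbs ≤ ∑ i, (m i).natAbs :=
    Finset.single_le_sum (f := fun i => (m i).natAbs) (fun _ _ => Nat.zero_le _) (Finset.mem_univ i)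
  omega

/-- A high power of the product of the variables clears all negative exponents. -/
theorem exists_mul_toLaurent_eq (a : Laurent n) : ∃ (N : ℕ) (p : MvPolynomial (Fin n) ℂ),
    a * toLaurent (∏ i, MvPolynomial.X i) ^ N = toLaurent p := by
  induction a using AddMonoidAlgebra.induction_linear with
  | zero => exact ⟨0, 0, by simp⟩
  | add a b ha hb =>
    obtain ⟨N, p, hp⟩ := ha
    obtain ⟨M, q, hq⟩ := hb
    refine ⟨N + M, p * (∏ i, MvPolynomial.X i) ^ M + q * (∏ i, MvPolynomial.X i) ^ N, ?_⟩
    rw [map_add, map_mul, map_mul, ← hp, ← hq, map_pow, map_pow]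
    ring
  | single m r =>
    obtain ⟨N, k, hk⟩ := exists_natCast_eq_add m
    refine ⟨N, MvPolynomial.C r * ∏ i, MvPolynomial.X i ^ k i, ?_⟩
    rw [← map_pow, ← Finset.prod_pow, toLaurent_prod_X_pow fun _ => N, map_mul,
      toLaurent_prod_X_pow, toLaurent, ← MvPolynomial.algebraMap_eq, AlgHom.commutes,
      Algebra.algebraMap_eq_smul_one, smul_one_mul, AddMonoidAlgebra.single_mul_single,
      AddMonoidAlgebra.smul_single, mul_one, smul_eq_mul, mul_one]
    exact congrArg (AddMonoidAlgebra.single · r) (funext fun i => (hk i).symm)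

theorem isUnit_toLaurent_prod_X : IsUnit (toLaurent (∏ i : Fin n, MvPolynomial.X i)) := by
  have h := toLaurent_prod_X_pow (n := n) fun _ => 1
  simp only [pow_one] at h
  rw [h]
  refine .of_mul_eq_one (AddMonoidAlgebra.single (fun _ => -1) 1) ?_
  rw [AddMonoidAlgebra.single_mul_single, AddMonoidAlgebra.one_def, one_mul]
  refine congrArg (AddMonoidAlgebra.single · 1) (funext fun i => ?_)
  simp

/-- The Laurent polynomials as an algebra over the polynomials. -/
@[reducible] def laurentAlgebra : Algebra (MvPolynomial (Fin n) ℂ) (Laurent n) :=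
  toLaurent.toAlgebra

attribute [local instance] laurentAlgebra

instance isLocalization_laurent :
    IsLocalization.Away (∏ i : Fin n, MvPolynomial.X i : MvPolynomial (Fin n) ℂ) (Laurent n) :=
  .mk _ isUnit_toLaurent_prod_X exists_mul_toLaurent_eq
    fun a b h => ⟨0, by rw [toLaurent_injective h]⟩

instance smooth_laurent : Algebra.Smooth ℂ (Laurent n) := by
  have : IsScalarTower ℂ (MvPolynomial (Fin n) ℂ) (Laurent n) :=
    .of_algebraMap_eq fun z => (toLaurent.commutes z).symm
  have : Algebra.Smooth (MvPolynomial (Fin n) ℂ) (Laurent n) :=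
    .of_isLocalization_Away (∏ i : Fin n, MvPolynomial.X i)
  have : Algebra.Smooth ℂ (MvPolynomial (Fin n) ℂ) := ⟨inferInstance, inferInstance⟩
  exact .comp ℂ (MvPolynomial (Fin n) ℂ) (Laurent n)

instance smooth_torus (n : ℕ) : Smooth (torus n ↘ SpecC) := by
  change Smooth (Spec.map _)
  rw [HasRingHomProperty.Spec_iff (P := @Smooth)]
  exact RingHom.smooth_algebraMap.2 smooth_laurent

theorem AlgPoints.laurent_ext {χ ψ : AlgPoints (Laurent n)}
    (h : ∀ p, χ (toLaurent p) = ψ (toLaurent p)) : χ = ψ := by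
  refine DFunLike.ext _ _ fun a => ?_
  obtain ⟨N, p, hp⟩ := exists_mul_toLaurent_eq a
  have h1 := congrArg χ hp
  have h2 := congrArg ψ hp
  have h0 : ψ (toLaurent (∏ i, MvPolynomial.X i)) ≠ 0 :=
    (isUnit_toLaurent_prod_X.map ψ).ne_zero
  rw [map_mul, map_pow, h, h, ← h2, map_mul, map_pow] at h1
  exact mul_right_cancel₀ (pow_ne_zero N h0) h1

theorem AlgPoints.apply_toLaurent (χ : AlgPoints (Laurent n)) (p : MvPolynomial (Fin n) ℂ) :
    χ (toLaurent p) = MvPolynomial.eval (fun i => χ (toLaurent (MvPolynomial.X i))) p := by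
  have h : (χ : Laurent n →ₐ[ℂ] ℂ).comp toLaurent =
      MvPolynomial.aeval (fun i => χ (toLaurent (MvPolynomial.X i))) := by
    ext k
    rw [MvPolynomial.aeval_X]
    rfl
  exact congrArg (fun ψ => ψ p) h

theorem AlgPoints.toLaurent_X_ne_zero (χ : AlgPoints (Laurent n)) (i : Fin n) :
    χ (toLaurent (MvPolynomial.X i)) ≠ 0 := by
  have h0 : χ (toLaurent (∏ i, MvPolynomial.X i)) ≠ 0 :=
    (isUnit_toLaurent_prod_X.map χ).ne_zero
  rw [map_prod, map_prod, Finset.prod_ne_zero_iff] at h0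
  exact h0 i (Finset.mem_univ i)

theorem range_laurentPoint (f g : MvPolynomial (Fin n) ℂ) :
    range (fun x : torusCompl f g => laurentPoint x.1 x.2.1) =
      {χ | χ (toLaurent f) ≠ 0 ∨ χ (toLaurent g) ≠ 0} := by
  ext χ
  constructor
  · rintro ⟨x, rfl⟩
    simpa only [mem_ofPred_eq, laurentPoint_toLaurent] using x.2.2
  · intro hχ
    rw [mem_ofPred_eq, χ.apply_toLaurent f, χ.apply_toLaurent g] at hχ
    refine ⟨⟨_, χ.toLaurent_X_ne_zero, hχ⟩, AlgPoints.laurent_ext fun p => ?_⟩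
    rw [laurentPoint_toLaurent, χ.apply_toLaurent]

theorem isOpenEmbedding_laurentPoint (f g : MvPolynomial (Fin n) ℂ) :
    IsOpenEmbedding fun x : torusCompl f g => laurentPoint x.1 x.2.1 := by
  let ev : AlgPoints (Laurent n) → (Fin n → ℂ) := fun χ i => χ (toLaurent (MvPolynomial.X i))
  have hev : ∀ x : torusCompl f g, ev (laurentPoint x.1 x.2.1) = x.1 := by
    intro x
    ext i
    change laurentPoint _ _ _ = _
    rw [laurentPoint_toLaurent, MvPolynomial.eval_X]
  have hevc : Continuous ev := continuous_pi fun i => AlgPoints.continuous_apply _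
  have hcont : Continuous fun x : torusCompl f g => laurentPoint x.1 x.2.1 := by
    refine continuous_induced_rng.2 (continuous_pi fun a => ?_)
    change Continuous fun x : torusCompl f g => laurentPoint x.1 x.2.1 a
    induction a using AddMonoidAlgebra.induction_linear with
    | zero => simpa only [map_zero] using continuous_const
    | add a b ha hb => simpa only [map_add] using ha.fun_add hb
    | single m r =>
      simp only [laurentPoint_single]
      refine continuous_const.mul (continuous_finsetProd _ fun i _ => ?_)
      exact ((continuous_apply i).comp continuous_subtype_val).zpow₀ _ fun x => .inl (x.2.1 i)
  refine ⟨⟨?_, ?_⟩, ?_⟩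
  · refine .of_comp hcont hevc ?_
    convert IsInducing.subtypeVal (t := torusCompl f g) using 1
    exact funext hev
  · intro x y h
    have := congrArg ev h
    simp only [hev] at this
    exact Subtype.ext this
  · rw [range_laurentPoint]
    exact (isOpen_ne_fun (AlgPoints.continuous_apply _) continuous_const).union
      (isOpen_ne_fun (AlgPoints.continuous_apply _) continuous_const)

end Torus

end ClusterType

end

/-! ### The divisor, the volume form and the smooth complement. -/

noncomputable section

namespace ClusterType

open Set Topology

section Pair

attribute [local instance] specOver

/-- The coefficients are locally finite, and on an open set `V` only the closures of points of `V`
are visible; locally the support is a finite union of closed sets. -/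
theorem isClosed_divisorSupport {X : Scheme.{0}} (B : AlgebraicCycle X ℤ) :
    IsClosed (divisorSupport B) := by
  rw [← isOpen_compl_iff, isOpen_iff_mem_nhds]
  intro y hy
  obtain ⟨t, ht, hfin⟩ := B.supportLocallyFiniteWithinDomain' y trivial
  obtain ⟨V, hVt, hV, hyV⟩ := mem_nhds_iff.1 ht
  have hcl : IsClosed (⋃ z ∈ t ∩ Function.support B.toFun, closure {z}) :=
    hfin.isClosed_biUnion fun _ _ => isClosed_closure
  refine Filter.mem_of_superset ((hV.inter hcl.isOpen_compl).mem_nhds ⟨hyV, fun h => hy ?_⟩) ?_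
  · simp only [mem_iUnion] at h
    obtain ⟨z, hz, hyz⟩ := h
    exact mem_biUnion (show z ∈ {z : X | B z ≠ 0} from hz.2) hyz
  · rintro w ⟨hwV, hw⟩ hwB
    simp only [divisorSupport, mem_iUnion] at hwB
    obtain ⟨z, hz, hwz⟩ := hwB
    obtain ⟨z', hzV, rfl⟩ := mem_closure_iff.1 hwz V hV hwV
    exact hw (mem_biUnion (show z' ∈ t ∩ Function.support B.toFun from ⟨hVt hzV, hz⟩) hwz)

theorem disjoint_divisorSupport {X : Scheme.{0}} {B : AlgebraicCycle X ℤ} {U : X.Opens}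
    (h : ∀ z ∈ U, B z = 0) {y : X} (hy : y ∈ U) : y ∉ divisorSupport B := by
  intro hyB
  simp only [divisorSupport, mem_iUnion] at hyB
  obtain ⟨z, hz, hyz⟩ := hyB
  obtain ⟨z', hzU, rfl⟩ := mem_closure_iff.1 hyz U U.2 hy
  exact hz (h _ hzU)

theorem isUnit_torusCoord (n : ℕ) (i : Fin n) : IsUnit (torusCoord n i) := by
  refine IsUnit.map (Scheme.ΓSpecIso (.of (Laurent n))).inv.hom ?_
  refine .of_mul_eq_one (AddMonoidAlgebra.single (-Pi.single i 1) 1) ?_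
  rw [AddMonoidAlgebra.single_mul_single, AddMonoidAlgebra.one_def, one_mul, add_neg_cancel]

namespace CodimOneEmbedding

variable {n : ℕ} {X : Scheme.{0}} [X.Over SpecC] (j : CodimOneEmbedding n X)

theorem exists_coord_eq [IsIntegral X] (i : Fin n) {z : X} (hz : z ∈ j.hom.opensRange) :
    ∃ u : (X.presheaf.stalk z)ˣ, j.coord i = algebraMap _ X.functionField u.1 := by
  have hz' : z ∈ j.hom ''ᵁ ⊤ := by rwa [Scheme.Hom.image_top_eq_opensRange]
  have h1 : IsUnit (X.presheaf.germ (j.hom ''ᵁ ⊤) z hz'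
      ((j.hom.appIso ⊤).inv (j.dom.ι.appTop (torusCoord n i)))) :=
    (((isUnit_torusCoord n i).map j.dom.ι.appTop.hom).map (j.hom.appIso ⊤).inv.hom).map
      (X.presheaf.germ (j.hom ''ᵁ ⊤) z hz').hom
  obtain ⟨u, hu⟩ := h1
  refine ⟨u, ?_⟩
  rw [hu]
  exact (Scheme.algebraMap_germ_eq_germToFunctionField X hz' _).symm

/-- At points of the image the coordinates are units of the local ring, so the denominators of the
form are harmless. -/
theorem volumeForm_mem_regularFormsAt [IsIntegral X] {z : X} (hz : z ∈ j.hom.opensRange) :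
    j.volumeForm ∈ regularFormsAt n z := by
  choose u hu using fun i => j.exists_coord_eq i hz
  have h1 : j.volumeForm = (∏ i, (j.coord i)⁻¹) • exteriorPower.ιMulti X.functionField n
      fun i => KaehlerDifferential.D ℂ X.functionField (j.coord i) :=
    (exteriorPower.ιMulti X.functionField n).toMultilinearMap.map_smul_univ _ _
  have h2 : ∏ i, (j.coord i)⁻¹ =
      algebraMap (X.presheaf.stalk z) X.functionField (∏ i, ((u i)⁻¹ : (X.presheaf.stalk z)ˣ).1) := by
    rw [map_prod]
    refine Finset.prod_congr rfl fun i _ => ?_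
    rw [hu, inv_eq_iff_eq_inv, eq_comm, inv_eq_iff_eq_inv]
    refine eq_inv_of_mul_eq_one_left ?_
    rw [← map_mul, Units.inv_mul, map_one]
  rw [h1, h2]
  refine Submodule.smul_mem (regularFormsAt n z) ⟨_, ⟨_, rfl⟩⟩
    (Submodule.subset_span ⟨fun i => (u i).1, ?_⟩)
  simp only [← hu]

theorem poleOrder_volumeForm [IsIntegral X] {z : X} (hz : z ∈ j.hom.opensRange) :
    poleOrder j.volumeForm z = 0 :=
  Nat.sInf_eq_zero.2 (.inl fun a _ =>
    Submodule.smul_mem (regularFormsAt n z) ⟨_, ⟨a, rfl⟩⟩ (j.volumeForm_mem_regularFormsAt hz))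

/-- Smoothness can be tested after an open immersion, and the source is open in the smooth torus. -/
theorem opensRange_le_smoothLocus [LocallyOfFiniteType (X ↘ SpecC)] :
    j.hom.opensRange ≤ (X ↘ SpecC).smoothLocus := by
  rintro _ ⟨y, rfl⟩
  have h : j.hom ⁻¹ᵁ (X ↘ SpecC).smoothLocus = ⊤ := by
    rw [Scheme.Hom.preimage_smoothLocus_eq, Scheme.Hom.smoothLocus_eq_top_iff, comp_over]
    exact inferInstanceAs (Smooth (j.dom.ι ≫ torus n ↘ SpecC))
  exact h.ge trivial

end CodimOneEmbedding

/-- If the complement of the domain of an embedding in codimension one is contained in the common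
zero locus of two relatively prime polynomials, the complex points outside a divisor that does not
meet the image are governed by the lattice of rank `n`. -/
theorem isQuotientOfLattice_smoothComplement {n : ℕ} {X : Scheme.{0}} [X.Over SpecC] [IsIntegral X]
    [LocallyOfFiniteType (X ↘ SpecC)] (j : CodimOneEmbedding n X) {B : AlgebraicCycle X ℤ}
    (hB : ∀ z ∈ j.hom.opensRange, B z = 0) {f g : MvPolynomial (Fin n) ℂ} (hf : f ≠ 0)
    (hfg : IsRelPrime f g)
    (hZ : ∀ z : torus n, z ∉ j.dom → toLaurent f ∈ PrimeSpectrum.asIdeal (R := Laurent n) z ∧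
      toLaurent g ∈ PrimeSpectrum.asIdeal (R := Laurent n) z) :
    IsQuotientOfLattice n (SmoothComplement X B) := by
  let Q : ComplexPoints X → Prop := fun p =>
    p.pt ∈ (X ↘ SpecC).smoothLocus ∧ p.pt ∉ divisorSupport B
  have hQ : IsOpen {p | Q p} := ComplexPoints.isOpen_setOf_pt_mem
    ((X ↘ SpecC).smoothLocus ⊓ ⟨(divisorSupport B)ᶜ, (isClosed_divisorSupport B).isOpen_compl⟩)
  have hmemQ : ∀ p, p.pt ∈ j.hom.opensRange → Q p := fun p hp =>
    ⟨j.opensRange_le_smoothLocus hp, disjoint_divisorSupport hB hp⟩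
  have hpt : ∀ (χ : AlgPoints (Laurent n)) (b : Laurent n),
      b ∈ PrimeSpectrum.asIdeal (R := Laurent n) χ.toComplexPoint.pt ↔ χ b = 0 := by
    intro χ b
    change χ b ∈ IsLocalRing.maximalIdeal ℂ ↔ _
    rw [IsLocalRing.mem_maximalIdeal, mem_nonunits_iff, isUnit_iff_ne_zero, not_not]
  let c : torusCompl f g → ComplexPoints (torus n) := fun x =>
    AlgPoints.toComplexPoint (laurentPoint x.1 x.2.1)
  have hc : IsOpenEmbedding c := (AlgPoints.isHomeomorph_toComplexPoint).isOpenEmbedding.comp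
    (isOpenEmbedding_laurentPoint f g)
  have hcdom : ∀ x, c x ∈ range (ComplexPoints.map j.dom.ι) := by
    intro x
    rw [ComplexPoints.range_map, Scheme.Opens.opensRange_ι]
    by_contra hx
    have h1 := hZ _ hx
    have h2 := (hpt _ _).1 h1.1
    have h3 := (hpt _ _).1 h1.2
    rw [laurentPoint_toLaurent] at h2 h3
    exact x.2.2.elim (· h2) (· h3)
  choose d hd using hcdom
  have hde : IsOpenEmbedding d := by
    refine .of_comp _ (ComplexPoints.isOpenEmbedding_map j.dom.ι) ?_
    rwa [show ComplexPoints.map j.dom.ι ∘ d = c from funext hd]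
  let F : torusCompl f g → {p // Q p} := fun x =>
    ⟨ComplexPoints.map j.hom (d x), hmemQ _ ⟨(d x).pt, rfl⟩⟩
  have hF : IsOpenEmbedding F :=
    .of_comp _ hQ.isOpenEmbedding_subtypeVal ((ComplexPoints.isOpenEmbedding_map j.hom).comp hde)
  -- The range of `F` need not be visibly Zariski open in `X`, but it contains all complex points of
  -- the image of `D`, which suffices for tameness.
  let D : (torus n).Opens := PrimeSpectrum.basicOpen (toLaurent f)
  have hD : (D : Set (torus n)).Nonempty := by
    refine ⟨(⟨⊥, Ideal.isPrime_bot⟩ : PrimeSpectrum (Laurent n)), ?_⟩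
    intro h
    exact hf (toLaurent_injective (by rw [map_zero]; exact h))
  obtain ⟨w, hwD, hwdom⟩ := nonempty_preirreducible_inter D.2 j.dom.2 hD
    (Set.nonempty_coe_sort.1 j.nonempty_dom)
  let U : X.Opens := j.hom ''ᵁ (j.dom.ι ⁻¹ᵁ D)
  have : Nonempty U := ⟨⟨j.hom ⟨w, hwdom⟩, ⟨_, hwD, rfl⟩⟩⟩
  have htame : IsTame (range F) := by
    refine (isTame_setOf_pt_mem X hQ (fun p hp => hp.1) U).mono ?_
    rintro ⟨y, hy⟩ ⟨v, hvD, hv⟩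
    obtain ⟨q, rfl⟩ : y ∈ range (ComplexPoints.map j.hom) := by
      rw [ComplexPoints.range_map]
      exact ⟨v, hv⟩
    obtain rfl : v = q.pt := j.hom.injective hv
    obtain ⟨χ, hχ⟩ : ∃ χ : AlgPoints (Laurent n),
        (AlgPoints.toComplexPoint χ : ComplexPoints (torus n)) = ComplexPoints.map j.dom.ι q :=
      AlgPoints.toComplexPoint_bijective.2 _
    have hχf : χ (toLaurent f) ≠ 0 := by
      rw [Ne, ← hpt, hχ]
      exact hvD
    obtain ⟨x, hx⟩ := (range_laurentPoint f g).ge (show χ ∈ _ from .inl hχf)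
    refine ⟨x, Subtype.ext (congrArg (ComplexPoints.map j.hom) ?_)⟩
    apply (ComplexPoints.isOpenEmbedding_map j.dom.ι).injective
    rw [hd]
    exact (congrArg AlgPoints.toComplexPoint hx).trans hχ
  exact (isQuotientOfLattice_torusCompl f g hfg).of_isTame ⟨F, hF.continuous⟩ hF htame

end Pair

end ClusterType

end

/-! ### Two relatively prime equations for a subset of codimension two. -/

noncomputable section

namespace ClusterType

open Set Topology

section Codimension

attribute [local instance] laurentAlgebra

/-- A closed subset of codimension at least two of the torus is contained in the common zero locus
of two relatively prime polynomials. -/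
theorem exists_isRelPrime_of_two_le_codim {n : ℕ} (U : (torus n).Opens)
    (hU : ∀ z : torus n, z ∉ U → 2 ≤ Order.coheight z) :
    ∃ f g : MvPolynomial (Fin n) ℂ, f ≠ 0 ∧ IsRelPrime f g ∧ ∀ z : torus n, z ∉ U →
      toLaurent f ∈ PrimeSpectrum.asIdeal (R := Laurent n) z ∧
      toLaurent g ∈ PrimeSpectrum.asIdeal (R := Laurent n) z := by
  classical
  have : IsNoetherianRing (Laurent n) :=
    IsLocalization.isNoetherianRing (.powers (∏ i : Fin n, MvPolynomial.X i : MvPolynomial (Fin n) ℂ)) _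
      inferInstance
  let Z : Set (PrimeSpectrum (Laurent n)) := {z | (show torus n from z) ∉ U}
  have hZ : IsClosed Z := U.2.isClosed_compl
  let I : Ideal (Laurent n) := PrimeSpectrum.vanishingIdeal Z
  -- By Krull's theorem a principal prime has height at most one, while the points of `Z` have
  -- codimension at least two.
  have hI : ∀ P : Ideal (Laurent n), P.IsPrime → P.IsPrincipal → ¬ I ≤ P := by
    intro P hP hP' hle
    have hmem : (⟨P, hP⟩ : PrimeSpectrum (Laurent n)) ∈ Z := by
      rw [← hZ.closure_eq, ← PrimeSpectrum.zeroLocus_vanishingIdeal_eq_closure,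
        PrimeSpectrum.mem_zeroLocus]
      exact hle
    have h2 := hU _ hmem
    have h1 : P.height ≤ 1 :=
      Ideal.height_le_one_of_isPrincipal_of_mem_minimalPrimes P P (by
        rw [Ideal.minimalPrimes_eq_subsingleton_self]; rfl)
    have h3 := idealHeight_eq_coheight (.of (Laurent n)) ⟨P, hP⟩
    have h4 : (2 : ℕ∞) ≤ 1 := (h2.trans h3.ge).trans h1
    exact absurd h4 (by decide)
  let J : Ideal (MvPolynomial (Fin n) ℂ) := I.comap (algebraMap _ _)
  have hmap : J.map (algebraMap _ (Laurent n)) = I :=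
    IsLocalization.map_under (.powers (∏ i : Fin n, MvPolynomial.X i)) _ I
  have hne : ∃ f, f ∈ J ∧ f ≠ 0 := by
    by_contra! h
    refine hI ⊥ Ideal.isPrime_bot inferInstance ?_
    rw [← hmap, (Submodule.eq_bot_iff J).2 h, Ideal.map_bot]
  -- Minimal degree ensures that no variable divides `f`: variables are units among Laurent
  -- polynomials and could be cancelled without leaving `J`. The prime factors of `f` therefore
  -- generate primes of the Laurent ring as well.
  obtain ⟨f, ⟨hfJ, hf0⟩, hfmin⟩ := WellFounded.has_min
    (InvImage.wf (MvPolynomial.totalDegree (R := ℂ) (σ := Fin n)) Nat.lt_wfRel.wf)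
    {f | f ∈ J ∧ f ≠ 0} hne
  have hX : ∀ i, ¬ MvPolynomial.X i ∣ f := by
    rintro i ⟨h, rfl⟩
    have h0 : h ≠ 0 := right_ne_zero_of_mul hf0
    have hJ : h ∈ J := by
      have hunit : IsUnit (toLaurent (MvPolynomial.X i)) :=
        isUnit_of_dvd_unit (map_dvd toLaurent (Finset.dvd_prod_of_mem _ (Finset.mem_univ i)))
          isUnit_toLaurent_prod_X
      have h1 : toLaurent (MvPolynomial.X i) * toLaurent h ∈ I := by
        rw [← map_mul]
        exact hfJ
      exact (Ideal.unit_mul_mem_iff_mem I hunit).1 h1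
    refine hfmin h ⟨hJ, h0⟩ ?_
    change MvPolynomial.totalDegree h < MvPolynomial.totalDegree (MvPolynomial.X i * h)
    rw [MvPolynomial.totalDegree_mul_of_isDomain (MvPolynomial.X_ne_zero i) h0,
      MvPolynomial.totalDegree_X]
    omega
  have hJq : ∀ q, Prime q → q ∣ f → ¬ J ≤ Ideal.span {q} := by
    intro q hq hqf hle
    have hqp : (Ideal.span {q}).IsPrime := (Ideal.span_singleton_prime hq.ne_zero).2 hq
    have hdisj : Disjoint ((Submonoid.powers (∏ i : Fin n, MvPolynomial.X i) :
        Submonoid (MvPolynomial (Fin n) ℂ)) : Set (MvPolynomial (Fin n) ℂ))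
        (Ideal.span {q} : Ideal (MvPolynomial (Fin n) ℂ)) := by
      rw [Set.disjoint_left]
      rintro _ ⟨k, rfl⟩ hk
      have h1 := hq.dvd_of_dvd_pow (Ideal.mem_span_singleton.1 hk)
      obtain ⟨i, -, hi⟩ := (Prime.dvd_finsetProd_iff hq _).1 h1
      exact hX i (((hq.irreducible.associated_of_dvd
        (MvPolynomial.X_prime (i := i)).irreducible hi).symm.dvd).trans hqf)
    refine hI ((Ideal.span {q}).map (algebraMap _ (Laurent n)))
      (IsLocalization.isPrime_of_isPrime_disjoint _ _ _ hqp hdisj) ?_ ?_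
    · rw [Ideal.map_span, Set.image_singleton]
      exact ⟨_, rfl⟩
    · rw [← hmap]
      exact Ideal.map_mono hle
  -- Prime avoidance for the finitely many prime factors of `f`.
  obtain ⟨g, hgJ, hg⟩ : ∃ g ∈ J, ∀ q ∈ (UniqueFactorizationMonoid.factors f).toFinset, ¬ q ∣ g := by
    by_contra! h
    have hsub : (J : Set (MvPolynomial (Fin n) ℂ)) ⊆
        ⋃ q ∈ (((UniqueFactorizationMonoid.factors f).toFinset : Finset _) : Set _),
          (Ideal.span {q} : Ideal (MvPolynomial (Fin n) ℂ)) := by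
      intro g hg
      obtain ⟨q, hq, hqg⟩ := h g hg
      exact mem_biUnion hq (Ideal.mem_span_singleton.2 hqg)
    -- The two `0`s are the indices at which primality would not be required; they play no role, as
    -- all the ideals are prime.
    rw [Ideal.subset_union_prime 0 0] at hsub
    · obtain ⟨q, hq, hle⟩ := hsub
      rw [Multiset.mem_toFinset] at hq
      exact hJq q (UniqueFactorizationMonoid.prime_of_factor q hq)
        (UniqueFactorizationMonoid.dvd_of_mem_factors hq) hle
    · intro q hq _ _
      rw [Multiset.mem_toFinset] at hq
      have := UniqueFactorizationMonoid.prime_of_factor q hq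
      exact (Ideal.span_singleton_prime this.ne_zero).2 this
  refine ⟨f, g, hf0, fun d hdf hdg => ?_, fun z hz =>
    ⟨(PrimeSpectrum.mem_vanishingIdeal _ _).1 hfJ _ hz,
      (PrimeSpectrum.mem_vanishingIdeal _ _).1 hgJ _ hz⟩⟩
  by_contra hd
  have hd0 : d ≠ 0 := by
    rintro rfl
    exact hf0 (zero_dvd_iff.1 hdf)
  obtain ⟨p, hp, hpd⟩ := WfDvdMonoid.exists_irreducible_factor hd hd0
  obtain ⟨q, hq, hpq⟩ := UniqueFactorizationMonoid.exists_mem_factors_of_dvd hf0 hp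
    (hpd.trans hdf)
  exact hg q (Multiset.mem_toFinset.2 hq) (hpq.symm.dvd.trans (hpd.trans hdg))

end Codimension

theorem fg_and_rank_le_of_surjective {n : ℕ} {G : Type*} [Group G]
    (φ : Multiplicative (Fin n → ℤ) →* G) (hφ : Function.Surjective φ) :
    ∃ _ : Group.FG G, Group.rank G ≤ n := by
  classical
  let S : Finset G := Finset.univ.image fun i : Fin n => φ (Multiplicative.ofAdd (Pi.single i 1))
  have hS : Subgroup.closure (S : Set G) = ⊤ := by
    refine top_le_iff.1 fun x _ => ?_
    obtain ⟨m, rfl⟩ := hφ x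
    have hm : m = ∏ i, Multiplicative.ofAdd (Pi.single i 1) ^ (Multiplicative.toAdd m i) := by
      apply Multiplicative.toAdd.injective
      rw [toAdd_prod]
      ext k
      simp [Finset.sum_apply, Pi.single_apply]
    have hgen : ∀ i : Fin n, Multiplicative.ofAdd (Pi.single i 1) ∈
        (Subgroup.closure (S : Set G)).comap φ := fun i =>
      Subgroup.mem_comap.2 (Subgroup.subset_closure (Finset.mem_coe.2 (Finset.mem_image.2
        ⟨i, Finset.mem_univ i, rfl⟩)))
    have hmem : m ∈ (Subgroup.closure (S : Set G)).comap φ := by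
      rw [hm]
      exact Subgroup.prod_mem _ fun i _ => Subgroup.zpow_mem _ (hgen i) _
    exact hmem
  have hfg : Group.FG G := ⟨⟨S, hS⟩⟩
  refine ⟨hfg, (Group.rank_le hS).trans ?_⟩
  exact Finset.card_image_le.trans (by simp)

end ClusterType

end

theorem mainTheorem5 (n : ℕ) (X : Scheme.{0}) [X.Over ClusterType.SpecC] [IsIntegral X]
    [IsSeparated (X ↘ ClusterType.SpecC)] [LocallyOfFiniteType (X ↘ ClusterType.SpecC)]
    [QuasiCompact (X ↘ ClusterType.SpecC)]
    (hnormal : ∀ x : X, IsIntegrallyClosed (X.presheaf.stalk x))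
    (hdim : topologicalKrullDim X = n)
    (B : AlgebraicCycle X ℤ) (hB : ClusterType.IsClusterTypePair n X B) :
    PathConnectedSpace (ClusterType.SmoothComplement X B) ∧
    ∀ x : ClusterType.SmoothComplement X B,
      (∀ a b : FundamentalGroup (ClusterType.SmoothComplement X B) x, a * b = b * a) ∧
      (∃ _ : Group.FG (FundamentalGroup (ClusterType.SmoothComplement X B) x),
        Group.rank (FundamentalGroup (ClusterType.SmoothComplement X B) x) ≤ n) ∧
      ∃ φ : Multiplicative (Fin n → ℤ) →* FundamentalGroup (ClusterType.SmoothComplement X B) x,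
        Function.Surjective φ := by
  obtain ⟨j, -, hBj⟩ := hB
  have hBz : ∀ z ∈ j.hom.opensRange, B z = 0 := fun z hz => by
    rw [hBj, j.poleOrder_volumeForm hz, Nat.cast_zero, ite_self]
  obtain ⟨f, g, hf, hfg, hZ⟩ :=
    ClusterType.exists_isRelPrime_of_two_le_codim j.dom j.two_le_codim
  have h := ClusterType.isQuotientOfLattice_smoothComplement j hBz hf hfg hZ
  refine ⟨h.1, fun x => ?_⟩
  obtain ⟨φ, hφ⟩ := h.exists_surjective x
  refine ⟨fun a b => ?_, ClusterType.fg_and_rank_le_of_surjective φ hφ, φ, hφ⟩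
  obtain ⟨a, rfl⟩ := hφ a
  obtain ⟨b, rfl⟩ := hφ b
  rw [← map_mul, mul_comm, map_mul]
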